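/- Notation. Let $b$ be a rational function in the closed unit ball of $H^\infty$ of the unit disc $\mathbb D$, with $\|b\|_\infty=1$, that is not a finite Blaschke product (unimodular constants count as finite Blaschke products). Let $\tilde a$ be its Pythagorean mate, i.e. the unique outer function in $H^\infty$ with $|\tilde a|^2+|b|^2=1$ almost everywhere on $\mathbb T$ and $\tilde a(0)>0$; it is rational, with zeros $\zeta_1,\dots,\zeta_n$ on $\mathbb T$ of multiplicities $m_1,\dots,m_n$, and we put $a(z)=\prod_{i=1}^n(z-\zeta_i)^{m_i}$. Let $\mathscr H(b)$ be the de Branges–Rovnyak space of $b$. For $\varphi:\mathbb D\to\mathbb D$ analytic, put $W_{u,\varphi}f=u\cdot (f\circ\varphi)$ and \[ \mathcal M_{\varphi,b}=\{u\in\mathscr H(b): W_{u,\varphi}\text{ is bounded from }\mathscr H(b)\text{ to itself}\}, \] and, for $u$ with $u\in\mathscr H(b)$ and $u\varphi\in\mathscr H(b)$, \[ w=\frac{u\cdot (a\circ\varphi)\cdot\prod_{j\in J}\bigl(\varphi-\varphi(\zeta_j)\bigr)^{m_j}}{a}, \] where $J$ is the set of the indices $j$ such that $\varphi(\zeta_j)\in\mathbb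 D$ and $u^{(\ell)}(\zeta_j)\neq0$ for some $0\le \ell\le m_j-1$, the values at $\zeta_j$ being non-tangential limits. Theorem. If $\varphi:\mathbb D\to\mathbb D$ is a finite Blaschke product, then \[ \mathcal M_{\varphi,b}=\{u\in\mathscr H(b): u\varphi\in\mathscr H(b)\text{ and }w\in H^\infty\}. \] -/

import Mathlib

namespace DeBranges

/-- The open unit disc. All functions below are functions `ℂ → ℂ` of which only the restriction
to the disc matters. -/
abbrev disc : Set ℂ := Metric.ball (0 : ℂ) 1

/-- Membership in the Hardy space `H^∞`: bounded analytic functions on the disc. -/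
def MemHInfty (f : ℂ → ℂ) : Prop :=
  DifferentiableOn ℂ f disc ∧ ∃ C : ℝ, ∀ z ∈ disc, ‖f z‖ ≤ C

/-- The norm of `H^∞`, that is the supremum of `|f|` over the disc. -/
noncomputable def normHInfty (f : ℂ → ℂ) : ℝ :=
  sSup ((fun z => ‖f z‖) '' disc)

/-- The quadratic integral means of `f` over the circles of radius `0 ≤ r < 1`, with respect to
normalized arc length. -/
noncomputable def squareMeans (f : ℂ → ℂ) : Set ℝ :=
  (fun r : ℝ => Real.circleAverage (fun z => ‖f z‖ ^ 2) 0 r) '' Set.Ico 0 1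

/-- Membership in the Hardy space `H^2`. -/
def MemH2 (f : ℂ → ℂ) : Prop :=
  DifferentiableOn ℂ f disc ∧ BddAbove (squareMeans f)

/-- The square of the norm of `H^2`. -/
noncomputable def sqNormH2 (f : ℂ → ℂ) : ℝ :=
  sSup (squareMeans f)

/-- The set of the numbers `‖f + b g‖² - ‖g‖²`, where `g` runs through `H^2`. -/
noncomputable def complementaryValues (b f : ℂ → ℂ) : Set ℝ :=
  {x | ∃ g : ℂ → ℂ, MemH2 g ∧ x = sqNormH2 (fun z => f z + b z * g z) - sqNormH2 g}

/-- Membership in the space `ℋ(b)` of de Branges and Rovnyak, for `b` in the closed unit ball of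
`H^∞`: the functions `f ∈ H^2` with `sup {‖f + b g‖² - ‖g‖² : g ∈ H^2} < ∞`. It is the
space complementary to `b H^2` in `H^2`; equivalently the range of `(1 - T_b T_b^*)^(1/2)` with the
range norm, or the Hilbert space with reproducing kernel
`(1 - b(z) conj (b(w))) / (1 - z conj w)`. -/
def MemHb (b f : ℂ → ℂ) : Prop :=
  MemH2 f ∧ BddAbove (complementaryValues b f)

/-- The norm of `ℋ(b)`, given by `‖f‖_b² = sup {‖f + b g‖² - ‖g‖² : g ∈ H^2}`. -/
noncomputable def normHb (b f : ℂ → ℂ) : ℝ :=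
  Real.sqrt (sSup (complementaryValues b f))

/-- The weighted composition operator `W_{u,φ} f = u · (f ∘ φ)`. -/
def weightedComp (u φ f : ℂ → ℂ) : ℂ → ℂ :=
  fun z => u z * f (φ z)

/-- `W_{u,φ}` is a bounded operator from `ℋ(b)` to itself. -/
def IsBoundedOnHb (b u φ : ℂ → ℂ) : Prop :=
  (∀ f, MemHb b f → MemHb b (weightedComp u φ f)) ∧
    ∃ C : ℝ, ∀ f, MemHb b f → normHb b (weightedComp u φ f) ≤ C * normHb b f

/-- The set `M_{φ,b}` of admissible weights. -/
def admissibleWeights (φ b : ℂ → ℂ) : Set (ℂ → ℂ) :=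
  {u | MemHb b u ∧ IsBoundedOnHb b u φ}

/-- Finite Blaschke products (`S` is the multiset of zeros; the empty product, a unimodular
constant, is included). -/
def IsFiniteBlaschkeProduct (f : ℂ → ℂ) : Prop :=
  ∃ (c : ℂ) (S : Multiset ℂ), ‖c‖ = 1 ∧ (∀ α ∈ S, ‖α‖ < 1) ∧
    ∀ z ∈ disc, f z = c * (S.map fun α => (z - α) / (1 - starRingEnd ℂ α * z)).prod

/-- Outer functions: `F(z) = c exp (∫ (ζ + z) / (ζ - z) h(ζ) dm(ζ))` with `|c| = 1` and `h` real
and integrable on the unit circle (so `h = log |F|` almost everywhere there). -/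
def IsOuter (F : ℂ → ℂ) : Prop :=
  ∃ (c : ℂ) (h : ℂ → ℝ), ‖c‖ = 1 ∧ CircleIntegrable h 0 1 ∧
    ∀ z ∈ disc, F z =
      c * Complex.exp (Real.circleAverage (fun ζ => (ζ + z) / (ζ - z) * (h ζ : ℂ)) 0 1)

/-- The function given by a rational function. -/
noncomputable def ratFun (r : RatFunc ℂ) : ℂ → ℂ :=
  fun z => r.eval (RingHom.id ℂ) z

/-- `A` is the Pythagorean mate of the rational function `b`: the outer function in `H^∞` with
`|A|² + |b|² = 1` on the unit circle and `A(0) > 0`. -/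
def IsPythagoreanMate (b A : RatFunc ℂ) : Prop :=
  MemHInfty (ratFun A) ∧ IsOuter (ratFun A) ∧
    (∀ ζ : ℂ, ‖ζ‖ = 1 → ‖ratFun A ζ‖ ^ 2 + ‖ratFun b ζ‖ ^ 2 = 1) ∧
    0 < (ratFun A 0).re ∧ (ratFun A 0).im = 0

open Classical in
/-- The distinct zeros on the unit circle of a rational function. -/
noncomputable def circleZeros (A : RatFunc ℂ) : Finset ℂ :=
  A.num.roots.toFinset.filter fun ζ => ‖ζ‖ = 1

/-- The multiplicity of a zero of a rational function. -/
noncomputable def zeroMult (A : RatFunc ℂ) (ζ : ℂ) : ℕ :=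
  A.num.rootMultiplicity ζ

/-- The polynomial `a(z) = ∏ (z - ζ_i)^{m_i}`, where the `ζ_i` are the zeros on the unit circle of
the Pythagorean mate `A` and the `m_i` their multiplicities. -/
noncomputable def boundaryFactor (A : RatFunc ℂ) : ℂ → ℂ :=
  fun z => ∏ ζ ∈ circleZeros A, (z - ζ) ^ zeroMult A ζ

/-- `f` has the non-tangential limit `l` at the point `ζ` of the unit circle. -/
def HasNTLimit (f : ℂ → ℂ) (ζ l : ℂ) : Prop :=
  ∀ κ : ℝ, 1 < κ →
    Filter.Tendsto f (nhdsWithin ζ {z | ‖z‖ < 1 ∧ ‖z - ζ‖ < κ * (1 - ‖z‖)}) (nhds l)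

open Classical in
/-- The boundary value at `ζ` of `f`, that is its non-tangential limit (`0` if there is none). -/
noncomputable def ntValue (f : ℂ → ℂ) (ζ : ℂ) : ℂ :=
  if h : ∃ l, HasNTLimit f ζ l then h.choose else 0

open Classical in
/-- The zeros `ζ` of `A` on the circle, of multiplicity `m`, with `u^(ℓ)(ζ) ≠ 0` for some
`0 ≤ ℓ ≤ m - 1` and `φ(ζ)` in the open disc, where the values at `ζ` are non-tangential limits. -/
noncomputable def interiorZeros (A : RatFunc ℂ) (u φ : ℂ → ℂ) : Finset ℂ :=
  (circleZeros A).filter fun ζ =>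
    (∃ ℓ < zeroMult A ζ, ∃ l : ℂ, HasNTLimit (iteratedDeriv ℓ u) ζ l ∧ l ≠ 0) ∧
      ∃ l ∈ disc, HasNTLimit φ ζ l

/-- The weight `w = u · (a ∘ φ) · ∏ (φ - φ(ζ_j))^{m_j} / a`, where the product is over the zeros
`ζ_j` in `interiorZeros A u φ`. -/
noncomputable def hardyWeight (A : RatFunc ℂ) (u φ : ℂ → ℂ) : ℂ → ℂ :=
  fun z =>
    u z * boundaryFactor A (φ z) *
        (∏ ζ ∈ interiorZeros A u φ, (φ z - ntValue φ ζ) ^ zeroMult A ζ) /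
      boundaryFactor A z

end DeBranges

/-! On the circle a finite Blaschke product has unimodular boundary values, so the set `J` is empty
and `w = u (a ∘ φ) / a` (`IsFiniteBlaschkeProduct.hardyWeight_eq`). The rest is a description of
`ℋ(b)` together with one family of test functions.

Description of `ℋ(b)`. Since `|A|² + |b|² = 1` on the circle, `‖f + bg‖² - ‖g‖² = ‖f‖² + 2 Re ⟨f,
bg⟩ - ‖Ag‖²` (`sqNormH2_add_mul`). Hence `f ∈ H²` lies in `ℋ(b)` exactly when `|⟨f, bg⟩| ≤ K ‖Ag‖`
for all `g ∈ H²`. The mate `A` is comparable with the polynomial `a` on the closed disc, and `b`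
does not vanish at the zeros of `a`. A Bézout identity therefore turns the estimate into `|⟨f, g⟩| ≤
K ‖ag‖` for polynomials `g`, which places `f` in the range of the Toeplitz operator with symbol
`conj a` (`exists_conj_toeplitz_eq`). With `N = deg a`, `conj a` is a constant times `z⁻ᴺ a` on the
circle, so `f = a h + p` with `h ∈ H²` and `deg p < N`, with norm control (`exists_decomposition`).
Conversely `a H²` and the polynomials lie in `ℋ(b)`. It follows that `φ` multiplies `ℋ(b)` into
itself (`memHb_mul_blaschke`).

Sufficiency. For `f = a h + ∑ pₙ zⁿ` one has `u · (f ∘ φ) = a w (h ∘ φ) + ∑ pₙ u φⁿ`. Littlewood's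
theorem and boundedness of `w` control the first term, and every `u φⁿ` lies in `ℋ(b)`.

Necessity. Testing `W_{u,φ}` on `a` times the Szegő kernel at `φ(z)`, and evaluating at `z`, gives
`|u (a ∘ φ)|² ≤ C (1 - |b|²)` (`exists_norm_sq_le`). On the circle the right side is `C |A|²`, which
is at most a multiple of `|a|²`; a maximum principle transfers this to the disc and bounds `w`. -/

namespace DeBranges

section

open Filter Topology Polynomial
open scoped ENNReal ComplexConjugate InnerProductSpace

/-! ### Taylor coefficients at the origin -/

/-- The Taylor coefficients of `f` at the origin. -/
noncomputable def taylorCoeff (f : ℂ → ℂ) (n : ℕ) : ℂ :=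
  (n.factorial : ℂ)⁻¹ * iteratedDeriv n f 0

lemma mem_disc {z : ℂ} : z ∈ disc ↔ ‖z‖ < 1 := by simp [disc]

lemma isOpen_disc : IsOpen disc := Metric.isOpen_ball

lemma hasSum_taylorCoeff {f : ℂ → ℂ} (hf : DifferentiableOn ℂ f disc) {z : ℂ} (hz : z ∈ disc) :
    HasSum (fun n => taylorCoeff f n * z ^ n) (f z) := by
  have h := Complex.hasSum_taylorSeries_on_ball hf hz
  refine h.congr_fun fun n => ?_
  simp [taylorCoeff]; ring

lemma hasFPowerSeriesOnBall_ofScalars {f : ℂ → ℂ} {c : ℕ → ℂ}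
    (h : ∀ z ∈ disc, HasSum (fun n => c n * z ^ n) (f z)) :
    HasFPowerSeriesOnBall f (FormalMultilinearSeries.ofScalars ℂ c) 0 1 := by
  refine ⟨?_, by norm_num, ?_⟩
  · refine ENNReal.le_of_forall_nnreal_lt fun r hr => ?_
    have hr1 : (r : ℝ) < 1 := by exact_mod_cast hr
    apply FormalMultilinearSeries.le_radius_of_summable_norm
    have hs := (h (r : ℂ) (by simpa [mem_disc] using hr1)).summable.norm
    refine hs.congr fun n => ?_
    simp
  · intro y hy
    have hy' : y ∈ disc := by
      rw [mem_disc]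
      simpa [Metric.mem_eball, edist_zero_right, ← ofReal_norm, ENNReal.ofReal_lt_one] using hy
    simpa [FormalMultilinearSeries.ofScalars_apply_eq, smul_eq_mul, mul_comm] using h y hy'

lemma differentiableOn_of_hasSum {f : ℂ → ℂ} {c : ℕ → ℂ}
    (h : ∀ z ∈ disc, HasSum (fun n => c n * z ^ n) (f z)) : DifferentiableOn ℂ f disc := by
  have := (hasFPowerSeriesOnBall_ofScalars h).differentiableOn
  refine this.mono fun z hz => ?_
  rw [mem_disc] at hz
  simpa [Metric.mem_eball, edist_zero_right, ← ofReal_norm, ENNReal.ofReal_lt_one] using hz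

lemma taylorCoeff_eq_of_hasSum {f : ℂ → ℂ} {c : ℕ → ℂ}
    (h : ∀ z ∈ disc, HasSum (fun n => c n * z ^ n) (f z)) : taylorCoeff f = c := by
  have h1 := hasFPowerSeriesOnBall_ofScalars h
  have h2 := hasFPowerSeriesOnBall_ofScalars
    (fun z hz => hasSum_taylorCoeff (differentiableOn_of_hasSum h) hz)
  have h3 := h2.hasFPowerSeriesAt.eq_formalMultilinearSeries h1.hasFPowerSeriesAt
  funext n
  have := congrArg (fun p : FormalMultilinearSeries ℂ ℂ ℂ => p.coeff n) h3
  simpa using this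

lemma summable_norm_taylorCoeff {f : ℂ → ℂ} (hf : DifferentiableOn ℂ f disc) {z : ℂ}
    (hz : z ∈ disc) : Summable fun n => ‖taylorCoeff f n * z ^ n‖ :=
  (hasSum_taylorCoeff hf hz).summable.norm

lemma taylorCoeff_add {f g : ℂ → ℂ} (hf : DifferentiableOn ℂ f disc)
    (hg : DifferentiableOn ℂ g disc) (n : ℕ) :
    taylorCoeff (fun z => f z + g z) n = taylorCoeff f n + taylorCoeff g n := by
  have := taylorCoeff_eq_of_hasSum (f := fun z => f z + g z)
    (c := fun n => taylorCoeff f n + taylorCoeff g n) fun z hz => by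
      simpa [add_mul] using (hasSum_taylorCoeff hf hz).add (hasSum_taylorCoeff hg hz)
  rw [this]

lemma taylorCoeff_const_mul {f : ℂ → ℂ} (hf : DifferentiableOn ℂ f disc) (c : ℂ) (n : ℕ) :
    taylorCoeff (fun z => c * f z) n = c * taylorCoeff f n := by
  have := taylorCoeff_eq_of_hasSum (f := fun z => c * f z)
    (c := fun n => c * taylorCoeff f n) fun z hz => by
      simpa [mul_assoc] using (hasSum_taylorCoeff hf hz).mul_left c
  rw [this]

lemma taylorCoeff_mul {f g : ℂ → ℂ} (hf : DifferentiableOn ℂ f disc)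
    (hg : DifferentiableOn ℂ g disc) (n : ℕ) :
    taylorCoeff (fun z => f z * g z) n =
      ∑ kl ∈ Finset.HasAntidiagonal.antidiagonal n, taylorCoeff f kl.1 * taylorCoeff g kl.2 := by
  have := taylorCoeff_eq_of_hasSum (f := fun z => f z * g z)
    (c := fun n => ∑ kl ∈ Finset.HasAntidiagonal.antidiagonal n, taylorCoeff f kl.1 * taylorCoeff g kl.2)
    fun z hz => by
      have h1 := summable_norm_taylorCoeff hf hz
      have h2 := summable_norm_taylorCoeff hg hz
      have h3 := tsum_mul_tsum_eq_tsum_sum_antidiagonal_of_summable_norm h1 h2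
      have h4 := (summable_norm_sum_mul_antidiagonal_of_summable_norm h1 h2).of_norm.hasSum
      rw [← h3, (hasSum_taylorCoeff hf hz).tsum_eq, (hasSum_taylorCoeff hg hz).tsum_eq] at h4
      refine h4.congr_fun fun n => ?_
      rw [Finset.sum_mul]
      refine Finset.sum_congr rfl fun kl hkl => ?_
      rw [← Finset.HasAntidiagonal.mem_antidiagonal.1 hkl, pow_add]; ring
  rw [this]

lemma taylorCoeff_polynomial (p : ℂ[X]) (n : ℕ) : taylorCoeff (fun z => p.eval z) n = p.coeff n := by
  have := taylorCoeff_eq_of_hasSum (f := fun z => p.eval z) (c := fun n => p.coeff n)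
    fun z hz => by
      rw [eval_eq_sum]
      exact hasSum_sum_of_ne_finset_zero fun n hn => by simp [notMem_support_iff.1 hn]
  rw [this]

lemma taylorCoeff_zero (f : ℂ → ℂ) : taylorCoeff f 0 = f 0 := by simp [taylorCoeff]

lemma taylorCoeff_congr {f g : ℂ → ℂ} (h : Set.EqOn f g disc) (n : ℕ) :
    taylorCoeff f n = taylorCoeff g n := by
  have : f =ᶠ[𝓝 0] g := h.eventuallyEq_of_mem (isOpen_disc.mem_nhds (by simp))
  rw [taylorCoeff, taylorCoeff, this.iteratedDeriv_eq]

/-! ### Quadratic means -/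

/-- The quadratic mean of `f` over the circle of radius `r`. -/
noncomputable def sqMean (f : ℂ → ℂ) (r : ℝ) : ℝ :=
  Real.circleAverage (fun z => ‖f z‖ ^ 2) 0 r

lemma sphere_subset_disc {r : ℝ} (h0 : 0 ≤ r) (h1 : r < 1) : Metric.sphere (0 : ℂ) |r| ⊆ disc := by
  intro z hz
  rw [mem_sphere_zero_iff_norm, abs_of_nonneg h0] at hz
  rw [mem_disc, hz]; exact h1

lemma circleIntegrable_of_continuousOn_disc {E : Type*} [NormedAddCommGroup E] {f : ℂ → E}
    (hf : ContinuousOn f disc) {r : ℝ}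
    (h0 : 0 ≤ r) (h1 : r < 1) : CircleIntegrable f 0 r :=
  (hf.mono (sphere_subset_disc h0 h1)).circleIntegrable'

/-- Parseval for polynomials on the unit circle, applied to the Taylor polynomials dilated by `r`;
these converge uniformly there, so the means pass to the limit. -/
lemma hasSum_sqMean {f : ℂ → ℂ} (hf : DifferentiableOn ℂ f disc) {r : ℝ} (h0 : 0 ≤ r)
    (h1 : r < 1) : HasSum (fun n => ‖taylorCoeff f n‖ ^ 2 * r ^ (2 * n)) (sqMean f r) := by
  set q : ℕ → ℂ[X] := fun N => ∑ n ∈ Finset.range N, monomial n (taylorCoeff f n * r ^ n) with hq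
  have hqe : ∀ N z, (q N).eval z = ∑ n ∈ Finset.range N, taylorCoeff f n * r ^ n * z ^ n := by
    intro N z; simp [hq, eval_finsetSum]
  have hqc : ∀ N n, (q N).coeff n = if n < N then taylorCoeff f n * r ^ n else 0 := by
    intro N n
    simp only [hq, finsetSum_coeff, coeff_monomial]
    simp
  have hsum : ∀ N, ∑ n ∈ Finset.range N, ‖taylorCoeff f n‖ ^ 2 * r ^ (2 * n) =
      Real.circleAverage (fun z => ‖(q N).eval z‖ ^ 2) 0 1 := by
    intro N
    rw [← sum_sq_norm_coeff_eq_circleAverage]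
    symm
    rw [Finset.sum_subset (s₂ := Finset.range N)]
    · refine Finset.sum_congr rfl fun n hn => ?_
      rw [hqc, if_pos (Finset.mem_range.1 hn)]
      simp [mul_pow, abs_of_nonneg h0, ← pow_mul, mul_comm]
    · intro n hn
      by_contra h
      rw [mem_support_iff, hqc, if_neg (by simpa using h)] at hn
      exact hn rfl
    · intro n _ hn
      simp [notMem_support_iff.1 hn]
  have hsumm : Summable fun n => ‖taylorCoeff f n * (r : ℂ) ^ n‖ :=
    summable_norm_taylorCoeff hf (by simpa [mem_disc, abs_of_nonneg h0] using h1)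
  have hunif : TendstoUniformlyOn (fun N z => (q N).eval z) (fun z => f (r * z)) atTop
      (Metric.sphere 0 1) := by
    have h2 := tendstoUniformlyOn_tsum_nat hsumm
      (f := fun n z => taylorCoeff f n * r ^ n * z ^ n) (s := Metric.sphere (0 : ℂ) 1)
      (fun n z hz => by
        rw [mem_sphere_zero_iff_norm] at hz
        simp [hz])
    refine (h2.congr ?_).congr_right ?_
    · exact Eventually.of_forall fun N z _ => (hqe N z).symm
    · intro z hz
      rw [mem_sphere_zero_iff_norm] at hz
      have := hasSum_taylorCoeff hf (z := r * z)
        (by simpa [mem_disc, abs_of_nonneg h0, hz] using h1)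
      simpa [mul_pow, mul_assoc] using this.tsum_eq
  have hlim : Tendsto (fun N => Real.circleAverage (fun z => ‖(q N).eval z‖ ^ 2) 0 1) atTop
      (𝓝 (sqMean f r)) := by
    have hmean : sqMean f r = Real.circleAverage (fun z => ‖f (r * z)‖ ^ 2) 0 1 := by
      rw [sqMean, Real.circleAverage_eq_circleAverage_zero_one]; simp
    rw [hmean]
    simp only [Real.circleAverage_def]
    refine Tendsto.const_smul ?_ _
    refine intervalIntegral.tendsto_integral_filter_of_dominated_convergence
      (fun _ => (∑' n, ‖taylorCoeff f n * (r : ℂ) ^ n‖) ^ 2) ?_ ?_ ?_ ?_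
    · refine Eventually.of_forall fun N => Continuous.aestronglyMeasurable ?_
      fun_prop
    · refine Eventually.of_forall fun N => Eventually.of_forall fun θ _ => ?_
      rw [norm_pow, norm_norm]
      refine pow_le_pow_left₀ (norm_nonneg _) ?_ 2
      rw [hqe]
      refine (norm_sum_le _ _).trans ((Finset.sum_le_sum fun n _ => ?_).trans
        (hsumm.sum_le_tsum (Finset.range N) fun _ _ => norm_nonneg _))
      simp
    · simp
    · refine Eventually.of_forall fun θ _ => ?_
      exact ((hunif.tendsto_at (by simp)).norm).pow 2
  have hnn : ∀ n, 0 ≤ ‖taylorCoeff f n‖ ^ 2 * r ^ (2 * n) := fun n => by positivity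
  rw [hasSum_iff_tendsto_nat_of_nonneg hnn]
  simpa [hsum] using hlim

lemma sqMean_nonneg (f : ℂ → ℂ) (r : ℝ) : 0 ≤ sqMean f r :=
  Real.circleAverage_nonneg_of_nonneg fun _ _ => by positivity

lemma sqMean_congr {f g : ℂ → ℂ} (h : Set.EqOn f g disc) {r : ℝ} (h0 : 0 ≤ r) (h1 : r < 1) :
    sqMean f r = sqMean g r :=
  Real.circleAverage_congr_sphere fun z hz => by
    simp only [h (sphere_subset_disc h0 h1 hz)]

lemma sqMean_le_sqMean {f : ℂ → ℂ} (hf : DifferentiableOn ℂ f disc) {r s : ℝ} (h0 : 0 ≤ r)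
    (hrs : r ≤ s) (h1 : s < 1) : sqMean f r ≤ sqMean f s :=
  hasSum_le (fun n => by gcongr) (hasSum_sqMean hf h0 (hrs.trans_lt h1))
    (hasSum_sqMean hf (h0.trans hrs) h1)

lemma squareMeans_nonempty (f : ℂ → ℂ) : (squareMeans f).Nonempty :=
  Set.Nonempty.image _ ⟨0, by simp⟩

lemma sqMean_le_sqNormH2 {f : ℂ → ℂ} (hf : MemH2 f) {r : ℝ} (h0 : 0 ≤ r) (h1 : r < 1) :
    sqMean f r ≤ sqNormH2 f :=
  le_csSup hf.2 ⟨r, ⟨h0, h1⟩, rfl⟩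

lemma sqNormH2_nonneg (f : ℂ → ℂ) : 0 ≤ sqNormH2 f :=
  Real.sSup_nonneg (by rintro _ ⟨r, _, rfl⟩; exact sqMean_nonneg f r)

/-- The means increase with the radius, so only radii close to `1` need to be estimated. -/
lemma memH2_of_sqMean_le {f : ℂ → ℂ} (hf : DifferentiableOn ℂ f disc) {X r₀ : ℝ} (hr₀ : r₀ < 1)
    (h : ∀ r, r₀ ≤ r → 0 ≤ r → r < 1 → sqMean f r ≤ X) : MemH2 f ∧ sqNormH2 f ≤ X := by
  have key : ∀ x ∈ squareMeans f, x ≤ X := by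
    rintro _ ⟨r, ⟨hr0, hr1⟩, rfl⟩
    exact (sqMean_le_sqMean hf hr0 (le_max_left r r₀) (max_lt hr1 hr₀)).trans
      (h _ (le_max_right _ _) (hr0.trans (le_max_left _ _)) (max_lt hr1 hr₀))
  exact ⟨⟨hf, X, key⟩, csSup_le (squareMeans_nonempty f) key⟩

lemma tendsto_sqMean {f : ℂ → ℂ} (hf : MemH2 f) :
    Tendsto (sqMean f) (𝓝[<] 1) (𝓝 (sqNormH2 f)) := by
  have hnn : ∀ᶠ r : ℝ in 𝓝[<] 1, 0 ≤ r ∧ r < 1 := by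
    filter_upwards [Ioo_mem_nhdsLT (show (0 : ℝ) < 1 by norm_num)] with r hr
    exact ⟨hr.1.le, hr.2⟩
  refine tendsto_order.2 ⟨fun a ha => ?_, fun a ha => ?_⟩
  · obtain ⟨_, ⟨s, ⟨hs0, hs1⟩, rfl⟩, hs⟩ := exists_lt_of_lt_csSup (squareMeans_nonempty f) ha
    filter_upwards [Ioo_mem_nhdsLT hs1] with r hr
    exact hs.trans_le (sqMean_le_sqMean hf.1 hs0 hr.1.le hr.2)
  · filter_upwards [hnn] with r hr
    exact (sqMean_le_sqNormH2 hf hr.1 hr.2).trans_lt ha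

lemma hasSum_sqNormH2 {f : ℂ → ℂ} (hf : MemH2 f) :
    HasSum (fun n => ‖taylorCoeff f n‖ ^ 2) (sqNormH2 f) := by
  have hle : ∀ N, ∑ n ∈ Finset.range N, ‖taylorCoeff f n‖ ^ 2 ≤ sqNormH2 f := by
    intro N
    have hc : Tendsto (fun r : ℝ => ∑ n ∈ Finset.range N, ‖taylorCoeff f n‖ ^ 2 * r ^ (2 * n))
        (𝓝[<] 1) (𝓝 (∑ n ∈ Finset.range N, ‖taylorCoeff f n‖ ^ 2 * (1 : ℝ) ^ (2 * n))) :=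
      (Continuous.tendsto (by fun_prop) 1).mono_left nhdsWithin_le_nhds
    simp only [one_pow, mul_one] at hc
    refine le_of_tendsto hc ?_
    filter_upwards [Ioo_mem_nhdsLT (show (0 : ℝ) < 1 by norm_num)] with r hr
    exact (sum_le_hasSum _ (fun n _ => mul_nonneg (sq_nonneg _) (pow_nonneg hr.1.le _))
      (hasSum_sqMean hf.1 hr.1.le hr.2)).trans (sqMean_le_sqNormH2 hf hr.1.le hr.2)
  have hs : Summable fun n => ‖taylorCoeff f n‖ ^ 2 :=
    summable_of_sum_range_le (fun _ => by positivity) hle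
  have h1 : ∑' n, ‖taylorCoeff f n‖ ^ 2 ≤ sqNormH2 f :=
    Real.tsum_le_of_sum_range_le (fun _ => by positivity) hle
  have h2 : sqNormH2 f ≤ ∑' n, ‖taylorCoeff f n‖ ^ 2 := by
    refine (memH2_of_sqMean_le hf.1 zero_lt_one fun r _ h0 h1 => ?_).2
    refine hasSum_le (fun n => ?_) (hasSum_sqMean hf.1 h0 h1) hs.hasSum
    exact mul_le_of_le_one_right (by positivity) (pow_le_one₀ h0 h1.le)
  rw [← le_antisymm h1 h2]
  exact hs.hasSum

lemma memH2_of_summable {f : ℂ → ℂ} (hf : DifferentiableOn ℂ f disc)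
    (hs : Summable fun n => ‖taylorCoeff f n‖ ^ 2) : MemH2 f := by
  refine (memH2_of_sqMean_le (X := ∑' n, ‖taylorCoeff f n‖ ^ 2) hf zero_lt_one
    fun r _ h0 h1 => ?_).1
  refine hasSum_le (fun n => ?_) (hasSum_sqMean hf h0 h1) hs.hasSum
  exact mul_le_of_le_one_right (by positivity) (pow_le_one₀ h0 h1.le)

lemma exists_memH2_taylorCoeff_eq {c : ℕ → ℂ} (hs : Summable fun n => ‖c n‖ ^ 2) :
    ∃ f, MemH2 f ∧ taylorCoeff f = c := by
  have h : ∀ z ∈ disc, HasSum (fun n => c n * z ^ n) (∑' n, c n * z ^ n) := by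
    intro z hz
    rw [mem_disc] at hz
    refine Summable.hasSum (Summable.of_norm ?_)
    have hg : Summable fun n => (‖z‖ ^ 2) ^ n :=
      summable_geometric_of_lt_one (by positivity) (by nlinarith [norm_nonneg z])
    refine Summable.of_nonneg_of_le (fun _ => norm_nonneg _) (fun n => ?_) (hs.add hg)
    rw [norm_mul, norm_pow, ← pow_mul, mul_comm 2 n, pow_mul]
    nlinarith [sq_nonneg (‖c n‖ - ‖z‖ ^ n), sq_nonneg (‖c n‖), sq_nonneg (‖z‖ ^ n)]
  have hc := taylorCoeff_eq_of_hasSum h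
  exact ⟨_, memH2_of_summable (differentiableOn_of_hasSum h) (by rwa [hc]), hc⟩

lemma MemH2.congr {f g : ℂ → ℂ} (hf : MemH2 f) (h : Set.EqOn f g disc) : MemH2 g :=
  (memH2_of_sqMean_le (hf.1.congr h.symm) zero_lt_one fun r _ h0 h1 => by
    rw [← sqMean_congr h h0 h1]; exact sqMean_le_sqNormH2 hf h0 h1).1

lemma sqNormH2_congr {f g : ℂ → ℂ} (h : Set.EqOn f g disc) : sqNormH2 f = sqNormH2 g := by
  have : squareMeans f = squareMeans g :=
    Set.image_congr fun r hr => sqMean_congr h hr.1 hr.2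
  rw [sqNormH2, sqNormH2, this]

/-- A pointwise estimate near the unit circle implies an estimate of the norms in `H^2`. -/
lemma memH2_of_norm_sq_le {f g₁ g₂ g₃ : ℂ → ℂ} (hf : DifferentiableOn ℂ f disc) (h₁ : MemH2 g₁)
    (h₂ : MemH2 g₂) (h₃ : MemH2 g₃) {C₁ C₂ C₃ r₀ : ℝ} (hC₁ : 0 ≤ C₁) (hC₂ : 0 ≤ C₂) (hC₃ : 0 ≤ C₃)
    (hr₀ : r₀ < 1)
    (h : ∀ z, r₀ ≤ ‖z‖ → z ∈ disc →
      ‖f z‖ ^ 2 ≤ C₁ * ‖g₁ z‖ ^ 2 + C₂ * ‖g₂ z‖ ^ 2 + C₃ * ‖g₃ z‖ ^ 2) :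
    MemH2 f ∧ sqNormH2 f ≤ C₁ * sqNormH2 g₁ + C₂ * sqNormH2 g₂ + C₃ * sqNormH2 g₃ := by
  refine memH2_of_sqMean_le hf hr₀ fun r hr h0 h1 => ?_
  have hfc := hf.continuousOn
  have hc₁ := h₁.1.continuousOn
  have hc₂ := h₂.1.continuousOn
  have hc₃ := h₃.1.continuousOn
  have hI : ∀ g : ℂ → ℂ, ContinuousOn g disc → ∀ C : ℝ,
      CircleIntegrable (fun z => C * ‖g z‖ ^ 2) 0 r := fun g hg C =>
    circleIntegrable_of_continuousOn_disc (by fun_prop) h0 h1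
  have hA : ∀ (g : ℂ → ℂ) (C : ℝ),
      Real.circleAverage (fun z => C * ‖g z‖ ^ 2) 0 r = C * sqMean g r := fun g C => by
    simpa [sqMean, smul_eq_mul] using
      Real.circleAverage_fun_smul (a := C) (f := fun z => ‖g z‖ ^ 2) (c := 0) (R := r)
  have h2 : sqMean f r ≤ Real.circleAverage
      ((fun z => C₁ * ‖g₁ z‖ ^ 2) + (fun z => C₂ * ‖g₂ z‖ ^ 2) + fun z => C₃ * ‖g₃ z‖ ^ 2) 0 r := by
    refine Real.circleAverage_mono (circleIntegrable_of_continuousOn_disc (by fun_prop) h0 h1)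
      (((hI _ hc₁ _).add (hI _ hc₂ _)).add (hI _ hc₃ _)) fun z hz => h z ?_
        (sphere_subset_disc h0 h1 hz)
    rw [mem_sphere_zero_iff_norm, abs_of_nonneg h0] at hz
    rwa [hz]
  rw [Real.circleAverage_add ((hI _ hc₁ _).add (hI _ hc₂ _)) (hI _ hc₃ _),
    Real.circleAverage_add (hI _ hc₁ _) (hI _ hc₂ _), hA, hA, hA] at h2
  refine h2.trans ?_
  gcongr <;> exact sqMean_le_sqNormH2 ‹_› h0 h1

lemma memH2_of_norm_sq_le_mul {f g : ℂ → ℂ} (hf : DifferentiableOn ℂ f disc) (hg : MemH2 g) {C : ℝ}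
    (hC : 0 ≤ C) (h : ∀ z ∈ disc, ‖f z‖ ^ 2 ≤ C * ‖g z‖ ^ 2) :
    MemH2 f ∧ sqNormH2 f ≤ C * sqNormH2 g := by
  simpa using memH2_of_norm_sq_le (C₂ := 0) (C₃ := 0) (r₀ := 0) hf hg hg hg hC le_rfl le_rfl
    zero_lt_one fun z _ hz => by simpa using h z hz

lemma MemH2.add {f g : ℂ → ℂ} (hf : MemH2 f) (hg : MemH2 g) : MemH2 (fun z => f z + g z) :=
  (memH2_of_norm_sq_le (C₁ := 2) (C₂ := 2) (C₃ := 0) (r₀ := 0) (hf.1.add hg.1) hf hg hg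
    (by norm_num) (by norm_num) le_rfl zero_lt_one fun z _ _ => by
      have := norm_add_le (f z) (g z)
      change ‖f z + g z‖ ^ 2 ≤ _
      nlinarith [norm_nonneg (f z + g z), sq_nonneg (‖f z‖ - ‖g z‖)]).1

lemma memH2_mul_of_bound {f g : ℂ → ℂ} (hf : DifferentiableOn ℂ f disc) {C : ℝ}
    (hC : ∀ z ∈ disc, ‖f z‖ ≤ C) (hg : MemH2 g) :
    MemH2 (fun z => f z * g z) ∧ sqNormH2 (fun z => f z * g z) ≤ C ^ 2 * sqNormH2 g :=
  memH2_of_norm_sq_le_mul (hf.mul hg.1) hg (sq_nonneg C) fun z hz => by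
    rw [Pi.mul_apply, norm_mul, mul_pow]
    have := hC z hz
    gcongr

lemma MemHInfty.mul_memH2 {f g : ℂ → ℂ} (hf : MemHInfty f) (hg : MemH2 g) :
    MemH2 (fun z => f z * g z) :=
  (memH2_mul_of_bound hf.1 hf.2.choose_spec hg).1

lemma memH2_const (c : ℂ) : MemH2 fun _ => c := by
  refine (memH2_of_sqMean_le (X := ‖c‖ ^ 2) (differentiableOn_const c) zero_lt_one
    fun r _ _ _ => ?_).1
  rw [sqMean, Real.circleAverage_const]

lemma MemH2.const_mul {f : ℂ → ℂ} (hf : MemH2 f) (c : ℂ) : MemH2 fun z => c * f z :=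
  (memH2_mul_of_bound (differentiableOn_const c) (fun _ _ => le_rfl) hf).1

lemma MemHInfty.memH2 {f : ℂ → ℂ} (hf : MemHInfty f) : MemH2 f := by
  simpa using hf.mul_memH2 (memH2_const 1)

lemma memHInfty_of_continuousOn {f : ℂ → ℂ} (hf : DifferentiableOn ℂ f disc)
    (hc : ContinuousOn f (Metric.closedBall 0 1)) : MemHInfty f := by
  obtain ⟨C, hC⟩ := (isCompact_closedBall (0 : ℂ) 1).exists_bound_of_continuousOn hc
  exact ⟨hf, C, fun z hz => hC z (Metric.ball_subset_closedBall hz)⟩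

lemma memHInfty_polynomial (p : ℂ[X]) : MemHInfty fun z => p.eval z :=
  memHInfty_of_continuousOn p.differentiable.differentiableOn p.continuous.continuousOn

lemma MemHInfty.mul {f g : ℂ → ℂ} (hf : MemHInfty f) (hg : MemHInfty g) :
    MemHInfty fun z => f z * g z := by
  obtain ⟨hf, C, hC⟩ := hf
  obtain ⟨hg, D, hD⟩ := hg
  refine ⟨hf.mul hg, C * D, fun z hz => ?_⟩
  rw [norm_mul]
  exact mul_le_mul (hC z hz) (hD z hz) (norm_nonneg _) ((norm_nonneg _).trans (hC z hz))

/-! ### The embedding of `H^2` into the space of square summable sequences -/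

/-- The sequence of Taylor coefficients of a function in `H^2` as an element of `ℓ²`. -/
noncomputable def toL2 (f : ℂ → ℂ) : lp (fun _ : ℕ => ℂ) 2 :=
  open Classical in if h : Memℓp (taylorCoeff f) 2 then ⟨taylorCoeff f, h⟩ else 0

lemma memℓp_two_iff {c : ℕ → ℂ} : Memℓp c 2 ↔ Summable fun n => ‖c n‖ ^ 2 := by
  rw [memℓp_gen_iff (by norm_num)]
  simp

lemma toL2_apply {f : ℂ → ℂ} (hf : MemH2 f) (n : ℕ) : toL2 f n = taylorCoeff f n := by
  rw [toL2, dif_pos (memℓp_two_iff.2 (hasSum_sqNormH2 hf).summable)]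

lemma norm_toL2_sq {f : ℂ → ℂ} (hf : MemH2 f) : ‖toL2 f‖ ^ 2 = sqNormH2 f := by
  have h := lp.norm_rpow_eq_tsum (p := 2) (by norm_num) (toL2 f)
  simp only [ENNReal.toReal_ofNat, Real.rpow_ofNat, toL2_apply hf] at h
  rw [h, (hasSum_sqNormH2 hf).tsum_eq]

lemma norm_toL2 {f : ℂ → ℂ} (hf : MemH2 f) : ‖toL2 f‖ = √(sqNormH2 f) := by
  rw [← norm_toL2_sq hf, Real.sqrt_sq (norm_nonneg _)]

lemma toL2_add {f g : ℂ → ℂ} (hf : MemH2 f) (hg : MemH2 g) :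
    toL2 (fun z => f z + g z) = toL2 f + toL2 g := by
  ext n
  simp [toL2_apply hf, toL2_apply hg, toL2_apply (hf.add hg), taylorCoeff_add hf.1 hg.1]

lemma toL2_const_mul {f : ℂ → ℂ} (hf : MemH2 f) (c : ℂ) :
    toL2 (fun z => c * f z) = c • toL2 f := by
  ext n
  simp [toL2_apply hf, toL2_apply (hf.const_mul c), taylorCoeff_const_mul hf.1]

lemma hasSum_inner_toL2 {f g : ℂ → ℂ} (hf : MemH2 f) (hg : MemH2 g) :
    HasSum (fun n => conj (taylorCoeff f n) * taylorCoeff g n) ⟪toL2 f, toL2 g⟫_ℂ := by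
  have := lp.hasSum_inner (𝕜 := ℂ) (toL2 f) (toL2 g)
  simpa [toL2_apply hf, toL2_apply hg, mul_comm] using this

/-! ### Reproducing kernels -/

/-- The Szegő kernel. -/
noncomputable def szegoKernel (w z : ℂ) : ℂ := (1 - conj w * z)⁻¹

lemma hasSum_szegoKernel {w z : ℂ} (hw : w ∈ disc) (hz : z ∈ disc) :
    HasSum (fun n => conj w ^ n * z ^ n) (szegoKernel w z) := by
  rw [mem_disc] at hw hz
  simp only [← mul_pow]
  refine hasSum_geometric_of_norm_lt_one ?_
  rw [norm_mul, RCLike.norm_conj]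
  exact mul_lt_one_of_nonneg_of_lt_one_left (norm_nonneg _) hw hz.le

lemma taylorCoeff_szegoKernel {w : ℂ} (hw : w ∈ disc) (n : ℕ) :
    taylorCoeff (szegoKernel w) n = conj w ^ n := by
  rw [taylorCoeff_eq_of_hasSum fun z hz => hasSum_szegoKernel hw hz]

lemma hasSum_norm_szegoKernel {w : ℂ} (hw : w ∈ disc) :
    HasSum (fun n => ‖taylorCoeff (szegoKernel w) n‖ ^ 2) (1 - ‖w‖ ^ 2)⁻¹ := by
  simp only [taylorCoeff_szegoKernel hw, norm_pow, RCLike.norm_conj, ← pow_mul, mul_comm _ 2]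
  simp only [pow_mul]
  rw [mem_disc] at hw
  exact hasSum_geometric_of_lt_one (by positivity) (by nlinarith [norm_nonneg w])

lemma memH2_szegoKernel {w : ℂ} (hw : w ∈ disc) : MemH2 (szegoKernel w) :=
  memH2_of_summable (differentiableOn_of_hasSum fun _ hz => hasSum_szegoKernel hw hz)
    (hasSum_norm_szegoKernel hw).summable

lemma sqNormH2_szegoKernel {w : ℂ} (hw : w ∈ disc) :
    sqNormH2 (szegoKernel w) = (1 - ‖w‖ ^ 2)⁻¹ :=
  (hasSum_sqNormH2 (memH2_szegoKernel hw)).unique (hasSum_norm_szegoKernel hw)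

lemma inner_szegoKernel {f : ℂ → ℂ} (hf : MemH2 f) {w : ℂ} (hw : w ∈ disc) :
    ⟪toL2 (szegoKernel w), toL2 f⟫_ℂ = f w := by
  refine (hasSum_inner_toL2 (memH2_szegoKernel hw) hf).unique ?_
  refine (hasSum_taylorCoeff hf.1 hw).congr_fun fun n => ?_
  simp [taylorCoeff_szegoKernel hw, mul_comm]

lemma one_sub_norm_sq_pos {w : ℂ} (hw : w ∈ disc) : 0 < 1 - ‖w‖ ^ 2 := by
  rw [mem_disc] at hw; nlinarith [norm_nonneg w]

lemma norm_sq_mul_le_sqNormH2 {f : ℂ → ℂ} (hf : MemH2 f) {w : ℂ} (hw : w ∈ disc) :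
    ‖f w‖ ^ 2 * (1 - ‖w‖ ^ 2) ≤ sqNormH2 f := by
  have h := norm_inner_le_norm (𝕜 := ℂ) (toL2 (szegoKernel w)) (toL2 f)
  rw [inner_szegoKernel hf hw] at h
  have h2 := pow_le_pow_left₀ (norm_nonneg _) h 2
  rw [mul_pow, norm_toL2_sq hf, norm_toL2_sq (memH2_szegoKernel hw), sqNormH2_szegoKernel hw] at h2
  have := one_sub_norm_sq_pos hw
  rwa [inv_mul_eq_div, le_div_iff₀ this] at h2

lemma norm_taylorCoeff_sq_le {f : ℂ → ℂ} (hf : MemH2 f) (n : ℕ) :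
    ‖taylorCoeff f n‖ ^ 2 ≤ sqNormH2 f :=
  le_hasSum (hasSum_sqNormH2 hf) n fun _ _ => by positivity

/-! ### Estimates near the unit circle -/

/-- The set where `H ≥ ε` is compact and misses the circle, so it stays at a positive distance from
it. This replaces boundary values by estimates on circles of radius close to `1`. -/
lemma exists_radius_le_of_nonpos_on_circle {H : ℂ → ℝ}
    (hH : ContinuousOn H (Metric.closedBall 0 1)) (h : ∀ z, ‖z‖ = 1 → H z ≤ 0) {ε : ℝ}
    (hε : 0 < ε) : ∃ r₀ < 1, ∀ z, r₀ ≤ ‖z‖ → ‖z‖ ≤ 1 → H z ≤ ε := by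
  have hK : IsCompact (Metric.closedBall (0 : ℂ) 1 ∩ H ⁻¹' Set.Ici ε) :=
    (isCompact_closedBall (0 : ℂ) 1).of_isClosed_subset
      (hH.preimage_isClosed_of_isClosed Metric.isClosed_closedBall isClosed_Ici)
      Set.inter_subset_left
  rcases Set.eq_empty_or_nonempty (Metric.closedBall (0 : ℂ) 1 ∩ H ⁻¹' Set.Ici ε) with he | hne
  · refine ⟨0, zero_lt_one, fun z _ hz => ?_⟩
    by_contra! hlt
    have : z ∈ Metric.closedBall (0 : ℂ) 1 ∩ H ⁻¹' Set.Ici ε := ⟨by simpa using hz, hlt.le⟩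
    rw [he] at this
    exact this
  · obtain ⟨w, hw, hmax⟩ := hK.exists_isMaxOn hne continuous_norm.continuousOn
    have hw1 : ‖w‖ < 1 := by
      refine lt_of_le_of_ne (by simpa using hw.1) fun h1 => ?_
      have := h w h1
      have h2 : ε ≤ H w := hw.2
      linarith
    refine ⟨(‖w‖ + 1) / 2, by linarith, fun z hz hz1 => ?_⟩
    by_contra! hlt
    have h3 : ‖z‖ ≤ ‖w‖ := hmax (show z ∈ Metric.closedBall (0 : ℂ) 1 ∩ H ⁻¹' Set.Ici ε from
      ⟨by simpa using hz1, hlt.le⟩)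
    linarith

lemma norm_le_of_norm_le_near_circle {f : ℂ → ℂ} (hf : DifferentiableOn ℂ f disc) {C r₀ : ℝ}
    (hr₀ : r₀ < 1) (h : ∀ z ∈ disc, r₀ ≤ ‖z‖ → ‖f z‖ ≤ C) {z : ℂ} (hz : z ∈ disc) :
    ‖f z‖ ≤ C := by
  rw [mem_disc] at hz
  obtain ⟨s, hs, hs1⟩ := exists_between (max_lt hr₀ hz)
  have hs0 : 0 < s := (norm_nonneg z).trans_lt ((le_max_right _ _).trans_lt hs)
  have hsub : Metric.closedBall (0 : ℂ) s ⊆ disc := Metric.closedBall_subset_ball hs1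
  have hd : DiffContOnCl ℂ f (Metric.ball 0 s) := by
    refine ⟨hf.mono (Metric.ball_subset_closedBall.trans hsub), ?_⟩
    rw [closure_ball _ hs0.ne']
    exact hf.continuousOn.mono hsub
  refine Complex.norm_le_of_forall_mem_frontier_norm_le Metric.isBounded_ball hd ?_
    (subset_closure (show z ∈ Metric.ball (0 : ℂ) s by
      simpa using (le_max_right _ _).trans_lt hs))
  intro w hw
  rw [frontier_ball _ hs0.ne', mem_sphere_zero_iff_norm] at hw
  exact h w (by rw [mem_disc, hw]; exact hs1) (by rw [hw]; exact ((le_max_left _ _).trans_lt hs).le)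

/-- If `|A|² + |b|² = 1` on the circle, then multiplication by the pair `(b, A)` is isometric
on `H^2`. -/
lemma sqNormH2_mul_add_sqNormH2_mul {A b g : ℂ → ℂ} (hA : DifferentiableOn ℂ A disc)
    (hb : DifferentiableOn ℂ b disc) (hAc : ContinuousOn A (Metric.closedBall 0 1))
    (hbc : ContinuousOn b (Metric.closedBall 0 1))
    (h : ∀ z, ‖z‖ = 1 → ‖A z‖ ^ 2 + ‖b z‖ ^ 2 = 1) (hg : MemH2 g) :
    sqNormH2 (fun z => b z * g z) + sqNormH2 (fun z => A z * g z) = sqNormH2 g := by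
  have hbg := (memHInfty_of_continuousOn hb hbc).mul_memH2 hg
  have hAg := (memHInfty_of_continuousOn hA hAc).mul_memH2 hg
  have hg0 := sqNormH2_nonneg g
  refine le_antisymm ?_ ?_
  · refine le_of_forall_pos_le_add fun ε hε => ?_
    -- The `+ 1` keeps the denominator positive when `g` vanishes.
    set δ := ε / (sqNormH2 g + 1) with hδ
    have hδ0 : 0 < δ := by positivity
    obtain ⟨r₀, hr₀, hr⟩ := exists_radius_le_of_nonpos_on_circle
      (H := fun z => ‖A z‖ ^ 2 + ‖b z‖ ^ 2 - 1) (by fun_prop) (fun z hz => by simp [h z hz]) hδ0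
    refine le_of_tendsto ((tendsto_sqMean hbg).add (tendsto_sqMean hAg)) ?_
    filter_upwards [Ioo_mem_nhdsLT (max_lt zero_lt_one hr₀)] with r hr1
    have h0 : 0 ≤ r := (le_max_left _ _).trans hr1.1.le
    have hgc := hg.1.continuousOn
    have hbgc := hbg.1.continuousOn
    have hAgc := hAg.1.continuousOn
    have hI : ∀ g : ℂ → ℂ, ContinuousOn g disc →
      CircleIntegrable (fun z => ‖g z‖ ^ 2) 0 r := fun g hg =>
        circleIntegrable_of_continuousOn_disc (by fun_prop) h0 hr1.2
    rw [sqMean, sqMean, ← Real.circleAverage_add (hI _ hbgc) (hI _ hAgc)]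
    have h2 : Real.circleAverage (fun z => (1 + δ) * ‖g z‖ ^ 2) 0 r = (1 + δ) * sqMean g r := by
      simpa [sqMean, smul_eq_mul] using
        Real.circleAverage_fun_smul (a := 1 + δ) (f := fun z => ‖g z‖ ^ 2) (c := 0) (R := r)
    have h3 : Real.circleAverage ((fun z => ‖b z * g z‖ ^ 2) + fun z => ‖A z * g z‖ ^ 2) 0 r ≤
        (1 + δ) * sqMean g r := by
      rw [← h2]
      refine Real.circleAverage_mono ((hI _ hbgc).add (hI _ hAgc))
        (circleIntegrable_of_continuousOn_disc (by fun_prop) h0 hr1.2) fun z hz => ?_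
      rw [mem_sphere_zero_iff_norm, abs_of_nonneg h0] at hz
      have := hr z (by rw [hz]; exact (le_max_right _ _).trans hr1.1.le) (by rw [hz]; exact hr1.2.le)
      simp only [Pi.add_apply, norm_mul, mul_pow]
      nlinarith [sq_nonneg ‖g z‖]
    refine h3.trans ((mul_le_mul_of_nonneg_left (sqMean_le_sqNormH2 hg h0 hr1.2)
      (by positivity)).trans ?_)
    have : δ * sqNormH2 g ≤ ε := by
      rw [hδ, div_mul_eq_mul_div, div_le_iff₀ (by positivity)]
      nlinarith
    linarith
  · refine le_of_forall_pos_le_add fun ε hε => ?_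
    set δ := ε / (sqNormH2 g + 1) with hδ
    have hδ0 : 0 < δ := by positivity
    obtain ⟨r₀, hr₀, hr⟩ := exists_radius_le_of_nonpos_on_circle
      (H := fun z => 1 - ‖A z‖ ^ 2 - ‖b z‖ ^ 2) (by fun_prop) (fun z hz => by linarith [h z hz]) hδ0
    have h1 := (memH2_of_norm_sq_le hg.1 hbg hAg hg zero_le_one zero_le_one hδ0.le hr₀
      fun z hz hz1 => by
        have := hr z hz (by rw [mem_disc] at hz1; exact hz1.le)
        simp only [norm_mul, mul_pow]
        nlinarith [sq_nonneg ‖g z‖]).2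
    have : δ * sqNormH2 g ≤ ε := by
      rw [hδ, div_mul_eq_mul_div, div_le_iff₀ (by positivity)]
      nlinarith
    linarith

/-! ### Composition operators on `H^2` -/

/-- Only the Taylor coefficient of order zero changes. -/
lemma sqNormH2_const_add {F : ℂ → ℂ} (hF : MemH2 F) (c : ℂ) :
    sqNormH2 (fun z => c + F z) = sqNormH2 F + ‖c + F 0‖ ^ 2 - ‖F 0‖ ^ 2 := by
  have h := (hasSum_sqNormH2 hF).update 0 (‖c + F 0‖ ^ 2)
  have hcoef : ∀ n, ‖taylorCoeff (fun z => c + F z) n‖ ^ 2 =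
      Function.update (fun n => ‖taylorCoeff F n‖ ^ 2) 0 (‖c + F 0‖ ^ 2) n := by
    intro n
    rcases Nat.eq_zero_or_pos n with rfl | hn
    · simp [taylorCoeff_zero]
    · have h1 := taylorCoeff_polynomial (C c) n
      rw [coeff_C_of_ne_zero hn.ne'] at h1
      simp only [eval_C] at h1
      rw [taylorCoeff_add (differentiableOn_const c) hF.1, h1, zero_add,
        Function.update_of_ne hn.ne']
  have h2 := (hasSum_sqNormH2 ((memH2_const c).add hF)).unique (h.congr_fun hcoef)
  rw [h2, taylorCoeff_zero]
  ring

/-- Induction by Horner's scheme `c₀ + φ G`, with `‖φ G‖ ≤ ‖G‖`. The value at the origin on the left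
is what closes the induction: it supplies the term `‖G 0‖²` that absorbs the interaction of `c₀`
with `φ(0) G(0)`. -/
lemma sqNormH2_sum_pow_le {φ : ℂ → ℂ} (hφ : DifferentiableOn ℂ φ disc)
    (hm : Set.MapsTo φ disc disc) (N : ℕ) (c : ℕ → ℂ) :
    sqNormH2 (fun z => ∑ n ∈ Finset.range N, c n * φ z ^ n) +
      ‖∑ n ∈ Finset.range N, c n * φ 0 ^ n‖ ^ 2 ≤
      2 * (1 + ‖φ 0‖ ^ 2) / (1 - ‖φ 0‖ ^ 2) * ∑ n ∈ Finset.range N, ‖c n‖ ^ 2 := by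
  have h0 : (0 : ℂ) ∈ disc := by simp
  have hφ1 : ∀ z ∈ disc, ‖φ z‖ ≤ 1 := fun z hz => (mem_disc.1 (hm hz)).le
  have hs := one_sub_norm_sq_pos (hm h0)
  induction N generalizing c with
  | zero =>
    have : sqNormH2 (fun _ => (0 : ℂ)) ≤ 0 :=
      (memH2_of_sqMean_le (differentiableOn_const 0) zero_lt_one fun r _ _ _ => by
        simp [sqMean, Real.circleAverage_const]).2
    simpa using this
  | succ N ih =>
    set G : ℂ → ℂ := fun z => ∑ n ∈ Finset.range N, c (n + 1) * φ z ^ n with hG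
    have hGm : MemH2 G := by
      refine MemHInfty.memH2 ⟨by fun_prop, ∑ n ∈ Finset.range N, ‖c (n + 1)‖, fun z hz => ?_⟩
      refine (norm_sum_le _ _).trans (Finset.sum_le_sum fun n _ => ?_)
      rw [norm_mul, norm_pow]
      exact mul_le_of_le_one_right (norm_nonneg _) (pow_le_one₀ (norm_nonneg _) (hφ1 z hz))
    have hsplit : ∀ z, ∑ n ∈ Finset.range (N + 1), c n * φ z ^ n = c 0 + φ z * G z := by
      intro z
      rw [Finset.sum_range_succ', hG]
      simp only [Finset.mul_sum, pow_zero, mul_one, pow_succ]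
      rw [add_comm]
      congr 1
      exact Finset.sum_congr rfl fun n _ => by ring
    have hφG := memH2_mul_of_bound hφ hφ1 hGm
    have ih' := ih fun n => c (n + 1)
    rw [funext hsplit, hsplit 0, sqNormH2_const_add hφG.1, Finset.sum_range_succ']
    change sqNormH2 G + ‖G 0‖ ^ 2 ≤ _ at ih'
    set K := 2 * (1 + ‖φ 0‖ ^ 2) / (1 - ‖φ 0‖ ^ 2) with hK
    have hφG2 := hφG.2
    have hKeq : K * (1 - ‖φ 0‖ ^ 2) = 2 * (1 + ‖φ 0‖ ^ 2) := by
      rw [hK]; field_simp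
    have hin : 2 * ‖c 0 + φ 0 * G 0‖ ^ 2 ≤ K * ‖c 0‖ ^ 2 + (1 + ‖φ 0‖ ^ 2) * ‖G 0‖ ^ 2 := by
      have h1 : ‖c 0 + φ 0 * G 0‖ ≤ ‖c 0‖ + ‖φ 0‖ * ‖G 0‖ :=
        (norm_add_le _ _).trans_eq (by rw [norm_mul])
      have h2 : ‖c 0 + φ 0 * G 0‖ ^ 2 ≤ (‖c 0‖ + ‖φ 0‖ * ‖G 0‖) ^ 2 := by gcongr
      refine le_of_mul_le_mul_right ?_ hs
      have h3 : (K * ‖c 0‖ ^ 2 + (1 + ‖φ 0‖ ^ 2) * ‖G 0‖ ^ 2) * (1 - ‖φ 0‖ ^ 2) =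
          2 * (1 + ‖φ 0‖ ^ 2) * ‖c 0‖ ^ 2 +
            (1 + ‖φ 0‖ ^ 2) * ‖G 0‖ ^ 2 * (1 - ‖φ 0‖ ^ 2) := by
        rw [← hKeq]; ring
      rw [h3]
      have h4 := mul_le_mul_of_nonneg_right h2 hs.le
      -- The two sides of the estimate differ by exactly this square; this is where the value of `K`
      -- comes from.
      nlinarith [sq_nonneg (2 * ‖φ 0‖ * ‖c 0‖ - (1 - ‖φ 0‖ ^ 2) * ‖G 0‖)]
    simp only [norm_mul, mul_pow] at hφG2 ⊢
    rw [mul_add]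
    linarith

/-- Littlewood's theorem: composition operators are bounded on `H^2`. -/
lemma exists_sqNormH2_comp_le {φ : ℂ → ℂ} (hφ : DifferentiableOn ℂ φ disc)
    (hm : Set.MapsTo φ disc disc) :
    ∃ K, 0 ≤ K ∧ ∀ h, MemH2 h →
      MemH2 (fun z => h (φ z)) ∧ sqNormH2 (fun z => h (φ z)) ≤ K * sqNormH2 h := by
  have hs := one_sub_norm_sq_pos (hm (show (0 : ℂ) ∈ disc by simp))
  set K := 2 * (1 + ‖φ 0‖ ^ 2) / (1 - ‖φ 0‖ ^ 2) with hK
  have hK0 : 0 ≤ K := by positivity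
  -- The factor `2` is lost when `h ∘ φ` is split into a Taylor polynomial in `φ` and a uniformly
  -- small remainder.
  refine ⟨2 * K, by positivity, fun h hh => ?_⟩
  have hcomp : DifferentiableOn ℂ (fun z => h (φ z)) disc := hh.1.comp hφ hm
  have hφ1 : ∀ z ∈ disc, ‖φ z‖ ≤ 1 := fun z hz => (mem_disc.1 (hm hz)).le
  refine memH2_of_sqMean_le hcomp zero_lt_one fun r _ h0 h1 => ?_
  refine le_of_forall_pos_le_add fun ε hε => ?_
  have hsph : IsCompact (φ '' Metric.sphere 0 |r|) :=
    (isCompact_sphere _ _).image_of_continuousOn (hφ.continuousOn.mono (sphere_subset_disc h0 h1))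
  obtain ⟨w, hw, hmax⟩ := hsph.exists_isMaxOn
    (Set.Nonempty.image _ (NormedSpace.sphere_nonempty.2 (abs_nonneg r)))
    continuous_norm.continuousOn
  have hwd : w ∈ disc := by
    obtain ⟨v, hv, rfl⟩ := hw
    exact hm (sphere_subset_disc h0 h1 hv)
  have hunif := tendstoUniformlyOn_tsum_nat (summable_norm_taylorCoeff hh.1 hwd)
    (f := fun n z => taylorCoeff h n * z ^ n) (s := φ '' Metric.sphere 0 |r|)
    (fun n z hz => by
      rw [norm_mul, norm_mul, norm_pow, norm_pow]
      have : ‖z‖ ≤ ‖w‖ := hmax hz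
      gcongr)
  rw [Metric.tendstoUniformlyOn_iff] at hunif
  obtain ⟨N, hN⟩ := (hunif (√(ε / 2)) (by positivity)).exists
  set P : ℂ → ℂ := fun z => ∑ n ∈ Finset.range N, taylorCoeff h n * φ z ^ n with hP
  have hPm : MemH2 P := by
    refine MemHInfty.memH2 ⟨by fun_prop, ∑ n ∈ Finset.range N, ‖taylorCoeff h n‖, fun z hz => ?_⟩
    refine (norm_sum_le _ _).trans (Finset.sum_le_sum fun n _ => ?_)
    rw [norm_mul, norm_pow]
    exact mul_le_of_le_one_right (norm_nonneg _) (pow_le_one₀ (norm_nonneg _) (hφ1 z hz))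
  have hPn : sqNormH2 P ≤ K * sqNormH2 h := by
    have h2 := sqNormH2_sum_pow_le hφ hm N (taylorCoeff h)
    have h3 := sum_le_hasSum (Finset.range N) (fun n _ => by positivity) (hasSum_sqNormH2 hh)
    have h4 := mul_le_mul_of_nonneg_left h3 hK0
    have h5 := sq_nonneg ‖∑ n ∈ Finset.range N, taylorCoeff h n * φ 0 ^ n‖
    linarith
  have hPc := hPm.1.continuousOn
  have hcc := hcomp.continuousOn
  have hI : CircleIntegrable (fun z => 2 * ‖P z‖ ^ 2) 0 r :=
    circleIntegrable_of_continuousOn_disc (by fun_prop) h0 h1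
  have h6 : sqMean (fun z => h (φ z)) r ≤
      Real.circleAverage ((fun z => 2 * ‖P z‖ ^ 2) + fun _ => ε) 0 r := by
    refine Real.circleAverage_mono (circleIntegrable_of_continuousOn_disc (hcc.norm.pow 2) h0 h1)
      (hI.add (circleIntegrable_const _ _ _)) fun z hz => ?_
    have hd := hN (φ z) ⟨z, hz, rfl⟩
    rw [(hasSum_taylorCoeff hh.1 (hm (sphere_subset_disc h0 h1 hz))).tsum_eq, dist_eq_norm] at hd
    change ‖h (φ z) - P z‖ < _ at hd
    have h7 : ‖h (φ z) - P z‖ ^ 2 ≤ ε / 2 := by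
      rw [← Real.sq_sqrt (show 0 ≤ ε / 2 by positivity)]
      gcongr
    have h8 : ‖h (φ z)‖ ≤ ‖P z‖ + ‖h (φ z) - P z‖ := by
      simpa using norm_add_le (P z) (h (φ z) - P z)
    have h9 : ‖h (φ z)‖ ^ 2 ≤ (‖P z‖ + ‖h (φ z) - P z‖) ^ 2 := by gcongr
    simp only [Pi.add_apply]
    nlinarith [sq_nonneg (‖P z‖ - ‖h (φ z) - P z‖)]
  rw [Real.circleAverage_add hI (circleIntegrable_const _ _ _), Real.circleAverage_const] at h6
  have h10 : Real.circleAverage (fun z => 2 * ‖P z‖ ^ 2) 0 r = 2 * sqMean P r := by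
    simpa [sqMean, smul_eq_mul] using
      Real.circleAverage_fun_smul (a := (2 : ℝ)) (f := fun z => ‖P z‖ ^ 2) (c := 0) (R := r)
  have h11 := sqMean_le_sqNormH2 hPm h0 h1
  linarith

/-! ### Pythagorean pairs and norm estimates in `ℋ(b)` -/

/-- The analytic functions `b` and `A` are continuous up to the circle, where
`|A|² + |b|² = 1`, and `A` has no zeros in the disc. -/
structure PythagoreanPair (b A : ℂ → ℂ) : Prop where
  diff_b : DifferentiableOn ℂ b disc
  diff_A : DifferentiableOn ℂ A disc
  cont_b : ContinuousOn b (Metric.closedBall 0 1)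
  cont_A : ContinuousOn A (Metric.closedBall 0 1)
  sq_add_sq : ∀ z, ‖z‖ = 1 → ‖A z‖ ^ 2 + ‖b z‖ ^ 2 = 1
  ne_zero : ∀ z ∈ disc, A z ≠ 0

/-- The function `f` belongs to `ℋ(b)` and the square of its norm is at most `X`. -/
def SqNormHbLe (b f : ℂ → ℂ) (X : ℝ) : Prop :=
  MemH2 f ∧ ∀ g, MemH2 g → sqNormH2 (fun z => f z + b z * g z) ≤ X + sqNormH2 g

lemma sqNormH2_zero : sqNormH2 (fun _ => (0 : ℂ)) = 0 :=
  le_antisymm (memH2_of_sqMean_le (differentiableOn_const 0) zero_lt_one fun r _ _ _ => by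
        simp [sqMean, Real.circleAverage_const]).2 (sqNormH2_nonneg _)

lemma SqNormHbLe.sqNormH2_le {b f : ℂ → ℂ} {X : ℝ} (h : SqNormHbLe b f X) : sqNormH2 f ≤ X := by
  simpa [sqNormH2_zero] using h.2 _ (memH2_const 0)

lemma SqNormHbLe.nonneg {b f : ℂ → ℂ} {X : ℝ} (h : SqNormHbLe b f X) : 0 ≤ X :=
  (sqNormH2_nonneg f).trans h.sqNormH2_le

lemma SqNormHbLe.mono {b f : ℂ → ℂ} {X Y : ℝ} (h : SqNormHbLe b f X) (hXY : X ≤ Y) :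
    SqNormHbLe b f Y :=
  ⟨h.1, fun g hg => (h.2 g hg).trans (by linarith)⟩

lemma complementaryValues_nonempty (b f : ℂ → ℂ) : (complementaryValues b f).Nonempty :=
  ⟨_, fun _ => 0, memH2_const 0, rfl⟩

lemma SqNormHbLe.le_of_mem {b f : ℂ → ℂ} {X : ℝ} (h : SqNormHbLe b f X) {x : ℝ}
    (hx : x ∈ complementaryValues b f) : x ≤ X := by
  obtain ⟨g, hg, rfl⟩ := hx
  linarith [h.2 g hg]

lemma SqNormHbLe.memHb {b f : ℂ → ℂ} {X : ℝ} (h : SqNormHbLe b f X) : MemHb b f :=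
  ⟨h.1, X, fun _ hx => h.le_of_mem hx⟩

lemma SqNormHbLe.normHb_le {b f : ℂ → ℂ} {X : ℝ} (h : SqNormHbLe b f X) : normHb b f ≤ √X :=
  Real.sqrt_le_sqrt (csSup_le (complementaryValues_nonempty b f) fun _ hx => h.le_of_mem hx)

lemma MemHb.sqNormHbLe {b f : ℂ → ℂ} (h : MemHb b f) : SqNormHbLe b f (normHb b f ^ 2) := by
  have hval : ∀ g, MemH2 g → sqNormH2 (fun z => f z + b z * g z) - sqNormH2 g ≤
      sSup (complementaryValues b f) := fun g hg => le_csSup h.2 ⟨g, hg, rfl⟩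
  have h0 : 0 ≤ sSup (complementaryValues b f) := by
    have := hval _ (memH2_const 0)
    simp only [mul_zero, add_zero, sqNormH2_zero, sub_zero] at this
    exact (sqNormH2_nonneg f).trans this
  refine ⟨h.1, fun g hg => ?_⟩
  rw [normHb, Real.sq_sqrt h0]
  linarith [hval g hg]

lemma SqNormHbLe.congr {b f g : ℂ → ℂ} {X : ℝ} (h : SqNormHbLe b f X) (hfg : Set.EqOn f g disc) :
    SqNormHbLe b g X := by
  refine ⟨h.1.congr hfg, fun k hk => ?_⟩
  rw [sqNormH2_congr (g := fun z => f z + b z * k z) fun z hz => by simp only [hfg hz]]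
  exact h.2 k hk

lemma sqNormH2_const_mul {f : ℂ → ℂ} (hf : MemH2 f) (c : ℂ) :
    sqNormH2 (fun z => c * f z) = ‖c‖ ^ 2 * sqNormH2 f := by
  rw [← norm_toL2_sq (hf.const_mul c), toL2_const_mul hf, norm_smul, mul_pow, norm_toL2_sq hf]

/-- Giving half of `g` to each summand costs `2 · 2 · ‖g / 2‖² = ‖g‖²`, exactly the term that the
definition allows. -/
lemma SqNormHbLe.add {b f₁ f₂ : ℂ → ℂ} {X₁ X₂ : ℝ} (hb : MemHInfty b) (h₁ : SqNormHbLe b f₁ X₁)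
    (h₂ : SqNormHbLe b f₂ X₂) : SqNormHbLe b (fun z => f₁ z + f₂ z) (2 * X₁ + 2 * X₂) := by
  refine ⟨h₁.1.add h₂.1, fun g hg => ?_⟩
  have hg' := hg.const_mul (1 / 2)
  have hk₁ := h₁.1.add (hb.mul_memH2 hg')
  have hk₂ := h₂.1.add (hb.mul_memH2 hg')
  have hn := sqNormH2_const_mul hg (1 / 2)
  have e : (fun z => f₁ z + f₂ z + b z * g z) = fun z => (f₁ z + b z * (1 / 2 * g z)) +
      (f₂ z + b z * (1 / 2 * g z)) := by
    funext z; ring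
  have h := (memH2_of_norm_sq_le (C₁ := 2) (C₂ := 2) (C₃ := 0) (r₀ := 0) (hk₁.1.add hk₂.1) hk₁ hk₂
    hk₁ (by norm_num) (by norm_num) le_rfl zero_lt_one fun z _ _ => by
      have := norm_add_le (f₁ z + b z * (1 / 2 * g z)) (f₂ z + b z * (1 / 2 * g z))
      change ‖(f₁ z + b z * (1 / 2 * g z)) + (f₂ z + b z * (1 / 2 * g z))‖ ^ 2 ≤ _
      set x := f₁ z + b z * (1 / 2 * g z)
      set y := f₂ z + b z * (1 / 2 * g z)
      nlinarith [norm_nonneg (x + y), sq_nonneg (‖x‖ - ‖y‖)]).2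
  rw [e]
  refine h.trans ?_
  have h3 := h₁.2 _ hg'
  have h4 := h₂.2 _ hg'
  rw [hn] at h3 h4
  norm_num at h3 h4 ⊢
  linarith

namespace PythagoreanPair

variable {b A : ℂ → ℂ}

lemma memHInfty_left (P : PythagoreanPair b A) : MemHInfty b :=
  memHInfty_of_continuousOn P.diff_b P.cont_b

lemma memHInfty_right (P : PythagoreanPair b A) : MemHInfty A :=
  memHInfty_of_continuousOn P.diff_A P.cont_A

lemma sqNormH2_add (P : PythagoreanPair b A) {g : ℂ → ℂ} (hg : MemH2 g) :
    sqNormH2 (fun z => b z * g z) + sqNormH2 (fun z => A z * g z) = sqNormH2 g :=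
  sqNormH2_mul_add_sqNormH2_mul P.diff_A P.diff_b P.cont_A P.cont_b P.sq_add_sq hg

lemma sqNormHbLe_zero (P : PythagoreanPair b A) : SqNormHbLe b (fun _ => 0) 0 := by
  refine ⟨memH2_const 0, fun g hg => ?_⟩
  simp only [zero_add]
  linarith [P.sqNormH2_add hg, sqNormH2_nonneg (fun z => A z * g z)]

lemma sqNormHbLe_const_mul (P : PythagoreanPair b A) {f : ℂ → ℂ} {X : ℝ} (h : SqNormHbLe b f X)
    (c : ℂ) : SqNormHbLe b (fun z => c * f z) (‖c‖ ^ 2 * X) := by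
  rcases eq_or_ne c 0 with rfl | hc
  · simpa using P.sqNormHbLe_zero
  refine ⟨h.1.const_mul c, fun g hg => ?_⟩
  have hg' := hg.const_mul c⁻¹
  have e : (fun z => c * f z + b z * g z) = fun z => c * (f z + b z * (c⁻¹ * g z)) := by
    funext z; field_simp
  have h2 := h.2 _ hg'
  rw [e, sqNormH2_const_mul (h.1.add (P.memHInfty_left.mul_memH2 hg'))]
  rw [sqNormH2_const_mul hg] at h2
  have hc0 : 0 < ‖c‖ ^ 2 := by positivity
  have h3 := mul_le_mul_of_nonneg_left h2 hc0.le
  refine h3.trans_eq ?_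
  rw [norm_inv]
  field_simp

/-- Expanding the square, `‖bg‖²` is replaced by `‖g‖² - ‖Ag‖²`. The form with `g` separated shows
that membership in `ℋ(b)` is a bound of `⟨f, bg⟩` by `‖Ag‖`. -/
lemma sqNormH2_add_mul (P : PythagoreanPair b A) {f g : ℂ → ℂ} (hf : MemH2 f) (hg : MemH2 g) :
    sqNormH2 (fun z => f z + b z * g z) = sqNormH2 f +
      2 * (⟪toL2 f, toL2 (fun z => b z * g z)⟫_ℂ).re + sqNormH2 g
        - ‖toL2 (fun z => A z * g z)‖ ^ 2 := by
  have hbg := P.memHInfty_left.mul_memH2 hg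
  have hAg := P.memHInfty_right.mul_memH2 hg
  rw [← norm_toL2_sq (hf.add hbg), toL2_add hf hbg, norm_add_sq (𝕜 := ℂ), norm_toL2_sq hf,
    norm_toL2_sq hbg, norm_toL2_sq hAg, ← P.sqNormH2_add hg]
  simp only [RCLike.re_to_complex]
  ring

lemma norm_inner_le (P : PythagoreanPair b A) {f g : ℂ → ℂ} {X : ℝ} (hf : SqNormHbLe b f X)
    (hg : MemH2 g) :
    ‖⟪toL2 f, toL2 (fun z => b z * g z)⟫_ℂ‖ ≤ √X * ‖toL2 (fun z => A z * g z)‖ := by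
  have hbg := P.memHInfty_left.mul_memH2 hg
  have hAg := P.memHInfty_right.mul_memH2 hg
  set I := ⟪toL2 f, toL2 (fun z => b z * g z)⟫_ℂ with hI
  set B := ‖toL2 (fun z => A z * g z)‖ with hB
  -- Replacing `g` by `t conj(I) g` makes the inner product real and gives a quadratic polynomial in
  -- `t` without negative values; its discriminant is the claim.
  have key : ∀ t : ℝ, 0 ≤ ‖I‖ ^ 2 * B ^ 2 * (t * t) + (-(2 * ‖I‖ ^ 2)) * t + X := by
    intro t
    have hcg := hg.const_mul (t * conj I)
    have h1 := hf.2 _ hcg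
    rw [P.sqNormH2_add_mul hf.1 hcg] at h1
    have e1 : (fun z => b z * (t * conj I * g z)) = fun z => (t * conj I) * (b z * g z) := by
      funext z; ring
    have e2 : (fun z => A z * (t * conj I * g z)) = fun z => (t * conj I) * (A z * g z) := by
      funext z; ring
    rw [e1, e2, toL2_const_mul hbg, toL2_const_mul hAg, inner_smul_right, ← hI, norm_smul, ← hB,
      mul_assoc, Complex.conj_mul'] at h1
    have e3 : ((t : ℂ) * ((‖I‖ : ℂ) ^ 2)).re = t * ‖I‖ ^ 2 := by
      norm_cast
    have e4 : ‖(t : ℂ) * conj I‖ ^ 2 = t ^ 2 * ‖I‖ ^ 2 := by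
      rw [norm_mul, RCLike.norm_conj, mul_pow]; simp
    rw [e3, mul_pow, e4] at h1
    have := sqNormH2_nonneg f
    nlinarith
  have hd := discrim_le_zero key
  rw [discrim] at hd
  have hX := hf.nonneg
  have hfin : ‖I‖ ^ 2 ≤ X * B ^ 2 := by
    rcases (sq_nonneg ‖I‖).eq_or_lt with h0 | h0
    · rw [← h0]; positivity
    · nlinarith
  have hB0 : 0 ≤ B := norm_nonneg _
  refine le_of_sq_le_sq ?_ (by positivity)
  rwa [mul_pow, Real.sq_sqrt hX]

/-- With `x = ‖Ag‖`, this is `2 K x - x² ≤ K²`. -/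
lemma sqNormHbLe_of_norm_inner_le (P : PythagoreanPair b A) {f : ℂ → ℂ} {K : ℝ} (hf : MemH2 f)
    (h : ∀ g, MemH2 g → ‖⟪toL2 f, toL2 (fun z => b z * g z)⟫_ℂ‖ ≤
      K * ‖toL2 (fun z => A z * g z)‖) : SqNormHbLe b f (sqNormH2 f + K ^ 2) := by
  refine ⟨hf, fun g hg => ?_⟩
  rw [P.sqNormH2_add_mul hf hg]
  have h1 := h g hg
  have h2 := Complex.re_le_norm ⟪toL2 f, toL2 (fun z => b z * g z)⟫_ℂ
  nlinarith [sq_nonneg (K - ‖toL2 (fun z => A z * g z)‖)]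

/-- The bound by the reproducing kernel of `ℋ(b)` on the diagonal, obtained without the kernel: a
multiple of the Szegő kernel is used as `g` in the definition of the norm. -/
lemma norm_sq_mul_le (P : PythagoreanPair b A) {f : ℂ → ℂ} {X : ℝ} (hf : SqNormHbLe b f X) {w : ℂ}
    (hw : w ∈ disc) (hbw : ‖b w‖ < 1) :
    ‖f w‖ ^ 2 * (1 - ‖w‖ ^ 2) ≤ X * (1 - ‖b w‖ ^ 2) := by
  have hd := one_sub_norm_sq_pos hw
  have hβ : 0 < 1 - ‖b w‖ ^ 2 := by nlinarith [norm_nonneg (b w)]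
  -- The optimal multiple; it makes `f + b g` take the value `f(w) / (1 - |b(w)|²)` at `w`.
  set s : ℂ := (1 - ‖w‖ ^ 2 : ℝ) * (conj (b w) * f w / (1 - ‖b w‖ ^ 2 : ℝ)) with hs
  have hk := memH2_szegoKernel hw
  have hg := hk.const_mul s
  have h1 := hf.2 _ hg
  have h2 := norm_sq_mul_le_sqNormH2 (hf.1.add (P.memHInfty_left.mul_memH2 hg)) hw
  rw [sqNormH2_const_mul hk, sqNormH2_szegoKernel hw] at h1
  have hkw : szegoKernel w w = ((1 - ‖w‖ ^ 2 : ℝ) : ℂ)⁻¹ := by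
    rw [szegoKernel, Complex.conj_mul']; push_cast; rfl
  have hdC : ((1 - ‖w‖ ^ 2 : ℝ) : ℂ) ≠ 0 := by exact_mod_cast hd.ne'
  have hβC : ((1 - ‖b w‖ ^ 2 : ℝ) : ℂ) ≠ 0 := by exact_mod_cast hβ.ne'
  have hval : f w + b w * (s * szegoKernel w w) = f w / ((1 - ‖b w‖ ^ 2 : ℝ) : ℂ) := by
    rw [hkw, hs, mul_comm (((1 - ‖w‖ ^ 2 : ℝ) : ℂ)), mul_assoc, mul_inv_cancel₀ hdC, mul_one,
      eq_div_iff hβC, add_mul, mul_assoc, div_mul_cancel₀ _ hβC, ← mul_assoc, Complex.mul_conj']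
    push_cast; ring
  rw [hval] at h2
  have hsn : ‖s‖ ^ 2 * (1 - ‖w‖ ^ 2)⁻¹ =
      (1 - ‖w‖ ^ 2) * (‖b w‖ ^ 2 * ‖f w‖ ^ 2) / (1 - ‖b w‖ ^ 2) ^ 2 := by
    rw [hs, norm_mul, norm_div, norm_mul, RCLike.norm_conj, Complex.norm_real, Complex.norm_real,
      Real.norm_of_nonneg hd.le, Real.norm_of_nonneg hβ.le]
    field_simp
  rw [hsn] at h1
  rw [norm_div, Complex.norm_real, Real.norm_of_nonneg hβ.le] at h2
  have h3 := h2.trans h1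
  have h4 : (‖f w‖ / (1 - ‖b w‖ ^ 2)) ^ 2 * (1 - ‖w‖ ^ 2) -
      (1 - ‖w‖ ^ 2) * (‖b w‖ ^ 2 * ‖f w‖ ^ 2) / (1 - ‖b w‖ ^ 2) ^ 2 =
      ‖f w‖ ^ 2 * (1 - ‖w‖ ^ 2) / (1 - ‖b w‖ ^ 2) := by
    field_simp
  have h5 : ‖f w‖ ^ 2 * (1 - ‖w‖ ^ 2) / (1 - ‖b w‖ ^ 2) ≤ X := by linarith
  rwa [div_le_iff₀ hβ] at h5

/-- The isometry `g ↦ (bg, Ag)` applied to the Szegő kernel at `w`, followed by point evaluation at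
`w`. -/
lemma sq_add_sq_le_one (P : PythagoreanPair b A) {w : ℂ} (hw : w ∈ disc) :
    ‖b w‖ ^ 2 + ‖A w‖ ^ 2 ≤ 1 := by
  have hd := one_sub_norm_sq_pos hw
  have hk := memH2_szegoKernel hw
  have h1 := P.sqNormH2_add hk
  have h2 := norm_sq_mul_le_sqNormH2 (P.memHInfty_left.mul_memH2 hk) hw
  have h3 := norm_sq_mul_le_sqNormH2 (P.memHInfty_right.mul_memH2 hk) hw
  have hkw : ‖szegoKernel w w‖ = (1 - ‖w‖ ^ 2)⁻¹ := by
    rw [szegoKernel, Complex.conj_mul', norm_inv]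
    congr 1
    rw [← Real.norm_of_nonneg hd.le, ← Complex.norm_real]
    push_cast; rfl
  rw [sqNormH2_szegoKernel hw] at h1
  rw [norm_mul, hkw] at h2 h3
  have h4 : (‖b w‖ ^ 2 + ‖A w‖ ^ 2) * (1 - ‖w‖ ^ 2)⁻¹ ≤ 1 * (1 - ‖w‖ ^ 2)⁻¹ := by
    calc _ = (‖b w‖ * (1 - ‖w‖ ^ 2)⁻¹) ^ 2 * (1 - ‖w‖ ^ 2) +
        (‖A w‖ * (1 - ‖w‖ ^ 2)⁻¹) ^ 2 * (1 - ‖w‖ ^ 2) := by field_simp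
      _ ≤ _ := by linarith
  exact le_of_mul_le_mul_right h4 (by positivity)

lemma norm_lt_one (P : PythagoreanPair b A) {w : ℂ} (hw : w ∈ disc) : ‖b w‖ < 1 := by
  have h1 := P.sq_add_sq_le_one hw
  have h2 := norm_pos_iff.2 (P.ne_zero w hw)
  nlinarith [norm_nonneg (b w)]

/-- If `|a|` is bounded by a multiple of `|A|`, then `a H^2` is contained in `ℋ(b)`. -/
lemma sqNormHbLe_mul (P : PythagoreanPair b A) {a h : ℂ → ℂ} {K L : ℝ}
    (ha : DifferentiableOn ℂ a disc) (hL : ∀ z ∈ disc, ‖a z‖ ≤ L)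
    (hK : ∀ z ∈ disc, ‖a z‖ ≤ K * ‖A z‖) (hh : MemH2 h) :
    SqNormHbLe b (fun z => a z * h z) ((L ^ 2 + K ^ 2) * sqNormH2 h) := by
  have hah := (memH2_mul_of_bound ha hL hh).1
  refine ⟨hah, fun g hg => ?_⟩
  have hbg := P.memHInfty_left.mul_memH2 hg
  have hAg := P.memHInfty_right.mul_memH2 hg
  have h1 := (memH2_of_norm_sq_le (r₀ := 0) (C₁ := L ^ 2 + K ^ 2) (hah.add hbg).1 hh hbg hAg
    (by positivity) zero_le_one zero_le_one zero_lt_one fun z _ hz => by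
      have h2 : ‖a z * h z + b z * g z‖ ≤ ‖a z‖ * ‖h z‖ + ‖b z * g z‖ :=
        (norm_add_le _ _).trans_eq (by rw [norm_mul (a z)])
      have h3 : ‖b z * g z‖ ≤ ‖g z‖ := by
        rw [norm_mul]
        exact mul_le_of_le_one_left (norm_nonneg _) (P.norm_lt_one hz).le
      have h4 := pow_le_pow_left₀ (norm_nonneg _) h2 2
      have h5 : (‖a z‖ * ‖h z‖) ^ 2 ≤ L ^ 2 * ‖h z‖ ^ 2 := by
        rw [mul_pow]; have := hL z hz; gcongr
      -- The cross term is split as `2 K |h| |Ag| ≤ K² |h|² + |Ag|²`; then `|Ag|²` joins `|bg|²`,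
      -- and together they integrate to `‖g‖²`.
      have h6 : ‖a z‖ * ‖h z‖ * ‖b z * g z‖ ≤ (K * ‖h z‖) * ‖A z * g z‖ := by
        calc _ ≤ (K * ‖A z‖) * ‖h z‖ * ‖g z‖ := by
              have := hK z hz
              gcongr
              exact mul_nonneg ((norm_nonneg _).trans this) (norm_nonneg _)
          _ = _ := by rw [norm_mul]; ring
      nlinarith [sq_nonneg (K * ‖h z‖ - ‖A z * g z‖)]).2
  rw [← P.sqNormH2_add hg]
  linarith

end PythagoreanPair

/-! ### Toeplitz operators with conjugate-analytic polynomial symbol -/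

/-- A version of Douglas' lemma: a functional dominated by `T` is represented by `T`. -/
lemma exists_inner_eq_of_norm_le {E H : Type*} [AddCommGroup E] [Module ℂ E]
    [NormedAddCommGroup H] [InnerProductSpace ℂ H] [CompleteSpace H] (T : E →ₗ[ℂ] H)
    (l : E →ₗ[ℂ] ℂ) {K : ℝ} (hK : 0 ≤ K) (h : ∀ e, ‖l e‖ ≤ K * ‖T e‖) :
    ∃ x : H, ‖x‖ ≤ K ∧ ∀ e, l e = ⟪x, T e⟫_ℂ := by
  -- The functional factors through the range of `T`; Hahn–Banach extends it to `H` and Riesz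
  -- represents it.
  have hker : LinearMap.ker T ≤ LinearMap.ker l := by
    intro e he
    rw [LinearMap.mem_ker] at he ⊢
    simpa [he] using h e
  set m : LinearMap.range T →ₗ[ℂ] ℂ :=
    ((LinearMap.ker T).liftQ l hker) ∘ₗ T.quotKerEquivRange.symm.toLinearMap with hm
  have hmT : ∀ e, m ⟨T e, LinearMap.mem_range_self T e⟩ = l e := by
    intro e
    have : T.quotKerEquivRange.symm ⟨T e, LinearMap.mem_range_self T e⟩ =
        (LinearMap.ker T).mkQ e := by
      rw [LinearEquiv.symm_apply_eq]; rfl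
    rw [hm, LinearMap.comp_apply, LinearEquiv.coe_coe, this]
    simp
  have hmK : ∀ y, ‖m y‖ ≤ K * ‖y‖ := by
    rintro ⟨_, e, rfl⟩
    rw [hmT]; exact h e
  obtain ⟨g, hg, hgn⟩ := exists_extension_norm_eq (LinearMap.range T) (m.mkContinuous K hmK)
  refine ⟨(InnerProductSpace.toDual ℂ H).symm g, ?_, fun e => ?_⟩
  · rw [LinearIsometryEquiv.norm_map, hgn]
    exact LinearMap.mkContinuous_norm_le _ hK _
  · rw [InnerProductSpace.toDual_symm_apply, ← hmT e]
    exact (hg ⟨T e, LinearMap.mem_range_self T e⟩).symm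

lemma toL2_congr {f g : ℂ → ℂ} (h : Set.EqOn f g disc) : toL2 f = toL2 g := by
  have : taylorCoeff f = taylorCoeff g := funext (taylorCoeff_congr h)
  rw [toL2, toL2, this]

lemma memH2_polynomial (p : ℂ[X]) : MemH2 fun z => p.eval z := (memHInfty_polynomial p).memH2

lemma inner_toL2_polynomial {f : ℂ → ℂ} (hf : MemH2 f) (p : ℂ[X]) :
    ⟪toL2 f, toL2 (fun z => p.eval z)⟫_ℂ =
      ∑ n ∈ p.support, conj (taylorCoeff f n) * p.coeff n := by
  refine (hasSum_inner_toL2 hf (memH2_polynomial p)).unique ?_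
  simp only [taylorCoeff_polynomial]
  exact hasSum_sum_of_ne_finset_zero fun n hn => by simp [notMem_support_iff.1 hn]

lemma norm_toL2_le {f g : ℂ → ℂ} (hf : DifferentiableOn ℂ f disc) (hg : MemH2 g) {C : ℝ}
    (hC : 0 ≤ C) (h : ∀ z ∈ disc, ‖f z‖ ≤ C * ‖g z‖) : ‖toL2 f‖ ≤ C * ‖toL2 g‖ := by
  obtain ⟨h1, h2⟩ := memH2_of_norm_sq_le_mul (C := C ^ 2) hf hg (by positivity) fun z hz => by
    rw [← mul_pow]; exact pow_le_pow_left₀ (norm_nonneg _) (h z hz) 2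
  refine le_of_sq_le_sq ?_ (by positivity)
  rwa [mul_pow, norm_toL2_sq h1, norm_toL2_sq hg]

lemma toL2_eq_of_taylorCoeff_eq {h : ℂ → ℂ} (hh : MemH2 h) {x : lp (fun _ : ℕ => ℂ) 2}
    (hx : taylorCoeff h = x) : toL2 h = x := by
  ext n; rw [toL2_apply hh, hx]

/-- Toeplitz operators with the symbol `conj a` are onto the functions `f` for which
`|⟨f, g⟩| ≤ K ‖a g‖`. -/
lemma exists_conj_toeplitz_eq {f : ℂ → ℂ} (hf : MemH2 f) (a : ℂ[X]) {K : ℝ} (hK : 0 ≤ K)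
    (h : ∀ g : ℂ[X], ‖⟪toL2 f, toL2 (fun z => g.eval z)⟫_ℂ‖ ≤
      K * ‖toL2 (fun z => a.eval z * g.eval z)‖) :
    ∃ k, MemH2 k ∧ sqNormH2 k ≤ K ^ 2 ∧ ∀ n, taylorCoeff f n =
      ∑ i ∈ Finset.range (a.natDegree + 1), conj (a.coeff i) * taylorCoeff k (n + i) := by
  let T : ℂ[X] →ₗ[ℂ] lp (fun _ : ℕ => ℂ) 2 :=
    { toFun := fun g => toL2 fun z => (a * g).eval z
      map_add' := fun g g' => by
        rw [← toL2_add (memH2_polynomial _) (memH2_polynomial _)]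
        simp only [mul_add, eval_add]
      map_smul' := fun c g => by
        rw [RingHom.id_apply, ← toL2_const_mul (memH2_polynomial _)]
        simp only [mul_smul_comm, eval_smul, smul_eq_mul] }
  let l : ℂ[X] →ₗ[ℂ] ℂ :=
    { toFun := fun g => ⟪toL2 f, toL2 fun z => g.eval z⟫_ℂ
      map_add' := fun g g' => by
        rw [← inner_add_right, ← toL2_add (memH2_polynomial _) (memH2_polynomial _)]
        simp only [eval_add]
      map_smul' := fun c g => by
        rw [RingHom.id_apply, smul_eq_mul, ← inner_smul_right,
          ← toL2_const_mul (memH2_polynomial _)]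
        simp only [eval_smul, smul_eq_mul] }
  obtain ⟨x, hxK, hx⟩ := exists_inner_eq_of_norm_le T l hK fun g => by
    simpa [T, l] using h g
  obtain ⟨k, hk, hkx⟩ := exists_memH2_taylorCoeff_eq (memℓp_two_iff.1 x.2)
  have hkL := toL2_eq_of_taylorCoeff_eq hk hkx
  refine ⟨k, hk, ?_, fun n => ?_⟩
  · rw [← norm_toL2_sq hk, hkL]; gcongr
  -- Testing against monomials reads off the Taylor coefficients of `f`.
  · have h1 := hx (X ^ n)
    simp only [T, l, LinearMap.coe_mk, AddHom.coe_mk] at h1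
    rw [← hkL, inner_toL2_polynomial hf, inner_toL2_polynomial hk,
      Finset.sum_eq_single n (fun m _ hm => by simp [coeff_X_pow, hm])
        (fun hn => by simp at hn)] at h1
    rw [coeff_X_pow_self, mul_one] at h1
    have h2 : ∑ m ∈ (a * X ^ n).support, conj (taylorCoeff k m) * (a * X ^ n).coeff m =
        ∑ i ∈ Finset.range (a.natDegree + 1), conj (taylorCoeff k (n + i)) * a.coeff i := by
      rw [Finset.sum_subset (s₂ := Finset.range (a.natDegree + 1 + n))]
      · rw [add_comm (a.natDegree + 1) n, Finset.sum_range_add,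
          Finset.sum_eq_zero fun m hm => ?_, zero_add]
        · exact Finset.sum_congr rfl fun i _ => by rw [add_comm n i, coeff_mul_X_pow]
        · rw [coeff_mul_X_pow', if_neg (by simpa using hm), mul_zero]
      · intro m hm
        have := le_natDegree_of_mem_supp m hm
        have h3 : (a * X ^ n).natDegree ≤ a.natDegree + n :=
          natDegree_mul_le.trans (by simp)
        rw [Finset.mem_range]; omega
      · intro m _ hm
        rw [notMem_support_iff.1 hm, mul_zero]
    rw [h2] at h1
    have h3 := congrArg conj h1
    rw [Complex.conj_conj, map_sum] at h3
    rw [h3]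
    exact Finset.sum_congr rfl fun i _ => by rw [map_mul, Complex.conj_conj, mul_comm]

lemma sqNormH2_le_of_taylorCoeff_shift {h k : ℂ → ℂ} (hh : MemH2 h) (hk : MemH2 k) (N : ℕ)
    (hhk : ∀ n, taylorCoeff h n = taylorCoeff k (n + N)) : sqNormH2 h ≤ sqNormH2 k := by
  refine hasSum_le_inj (fun n => n + N) (add_left_injective N) (fun _ _ => by positivity)
    (fun n => ?_) (hasSum_sqNormH2 hh) (hasSum_sqNormH2 hk)
  rw [hhk]

/-- If the polynomial `a` is self-reciprocal, the range of the Toeplitz operator with symbol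
`conj a` is the sum of `a H^2` and of the polynomials of degree less than the degree of `a`. -/
lemma exists_eq_mul_add_polynomial {f k : ℂ → ℂ} (hf : MemH2 f) (hk : MemH2 k) {a : ℂ[X]} {κ : ℂ}
    (ha : ∀ i ≤ a.natDegree, conj (a.coeff i) = κ * a.coeff (a.natDegree - i))
    (h : ∀ n, taylorCoeff f n =
      ∑ i ∈ Finset.range (a.natDegree + 1), conj (a.coeff i) * taylorCoeff k (n + i)) :
    ∃ h, MemH2 h ∧ sqNormH2 h ≤ ‖κ‖ ^ 2 * sqNormH2 k ∧ ∀ z ∈ disc, f z = a.eval z * h z +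
      ∑ n ∈ Finset.range a.natDegree,
        (taylorCoeff f n - taylorCoeff (fun z => a.eval z * h z) n) * z ^ n := by
  set N := a.natDegree with hN
  -- On the circle `conj a = κ z⁻ᴺ a`. Writing `k = r + zᴺ k'` with `deg r < N`, the part `zᴺ k'`
  -- contributes `κ a k'` and the part `r` contributes only coefficients of order less than `N`.
  obtain ⟨k', hk', hkk⟩ := exists_memH2_taylorCoeff_eq (c := fun n => taylorCoeff k (n + N))
    ((hasSum_sqNormH2 hk).summable.comp_injective (add_left_injective N))
  have hh := hk'.const_mul κ
  have hah := (memHInfty_polynomial a).mul_memH2 hh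
  refine ⟨fun z => κ * k' z, hh, ?_, fun z hz => ?_⟩
  · rw [sqNormH2_const_mul hk']
    have := sqNormH2_le_of_taylorCoeff_shift hk' hk N fun n => by rw [hkk]
    gcongr
  · have hcoef : ∀ n, N ≤ n → taylorCoeff f n =
        taylorCoeff (fun z => a.eval z * (κ * k' z)) n := by
      intro n hn
      rw [taylorCoeff_mul a.differentiable.differentiableOn hh.1,
        Finset.Nat.sum_antidiagonal_eq_sum_range_succ
          (fun i j => taylorCoeff (fun z => a.eval z) i * taylorCoeff (fun z => κ * k' z) j) n,
        ← Finset.sum_subset (Finset.range_subset_range.2 (Nat.succ_le_succ hn)), h,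
        ← Finset.sum_range_reflect]
      · refine Finset.sum_congr rfl fun i hi => ?_
        have hi' := Finset.mem_range_succ_iff.1 hi
        rw [taylorCoeff_polynomial, taylorCoeff_const_mul hk'.1, hkk, add_tsub_cancel_right,
          ha _ (Nat.sub_le _ _), Nat.sub_sub_self hi']
        have : n + (N - i) = n - i + N := by omega
        rw [this]; ring
      · intro i _ hi
        rw [taylorCoeff_polynomial, coeff_eq_zero_of_natDegree_lt, zero_mul]
        simpa using hi
    have h1 := hasSum_taylorCoeff hf.1 hz
    have h2 := hasSum_taylorCoeff hah.1 hz
    have h3 : HasSum (fun n => taylorCoeff f n * z ^ n -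
        taylorCoeff (fun z => a.eval z * (κ * k' z)) n * z ^ n)
        (∑ n ∈ Finset.range N, (taylorCoeff f n * z ^ n -
          taylorCoeff (fun z => a.eval z * (κ * k' z)) n * z ^ n)) :=
      hasSum_sum_of_ne_finset_zero fun n hn => by
        rw [hcoef n (by simpa using hn), sub_self]
    have h4 := (h1.sub h2).unique h3
    simp only [sub_mul]
    rw [← h4]; ring

/-! ### Polynomials in `ℋ(b)` and the decomposition `a H² + polynomials` -/

namespace PythagoreanPair

variable {b A : ℂ → ℂ}

/-- For `zⁿ` the inner product with `bg` is the `n`-th coefficient of `(b / A) (A g)`, where `b / A`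
is analytic in the disc. It involves finitely many coefficients of `A g`, each at most `‖A g‖`. -/
lemma exists_sqNormHbLe_polynomial (P : PythagoreanPair b A) (p : ℂ[X]) :
    ∃ X, SqNormHbLe b (fun z => p.eval z) X := by
  induction p using Polynomial.induction_on' with
  | add p q hp hq =>
    obtain ⟨X, hX⟩ := hp
    obtain ⟨Y, hY⟩ := hq
    exact ⟨_, (hX.add P.memHInfty_left hY).congr fun z _ => by simp⟩
  | monomial n c =>
    have hq : DifferentiableOn ℂ (fun z => b z / A z) disc := P.diff_b.div P.diff_A P.ne_zero
    have h1 := P.sqNormHbLe_of_norm_inner_le (memH2_polynomial (X ^ n))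
      (K := ∑ kl ∈ Finset.HasAntidiagonal.antidiagonal n, ‖taylorCoeff (fun z => b z / A z) kl.1‖)
      fun g hg => by
        have hbg := P.memHInfty_left.mul_memH2 hg
        have hAg := P.memHInfty_right.mul_memH2 hg
        have e : taylorCoeff (fun z => b z * g z) n =
            taylorCoeff (fun z => b z / A z * (A z * g z)) n :=
          taylorCoeff_congr (fun z hz => by
            have := P.ne_zero z hz
            field_simp) n
        rw [← inner_conj_symm, inner_toL2_polynomial hbg, RCLike.norm_conj,
          Finset.sum_eq_single n (fun m _ hm => by simp [coeff_X_pow, hm])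
            (fun hn => by simp at hn), coeff_X_pow_self, mul_one, RCLike.norm_conj,
          e, taylorCoeff_mul hq hAg.1, Finset.sum_mul]
        refine (norm_sum_le _ _).trans (Finset.sum_le_sum fun kl _ => ?_)
        rw [norm_mul]
        gcongr
        rw [norm_toL2 hAg]
        exact Real.le_sqrt_of_sq_le (norm_taylorCoeff_sq_le hAg _)
    exact ⟨_, (P.sqNormHbLe_const_mul h1 c).congr fun z _ => by simp⟩

/-- The functions in `ℋ(b)` are of the form `a h + p` with `h ∈ H^2` and a polynomial `p` of degree
less than the degree of `a`, with control of the norms. -/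
lemma exists_decomposition (P : PythagoreanPair b A) {a : ℂ[X]} {κ : ℂ}
    (ha : ∀ i ≤ a.natDegree, conj (a.coeff i) = κ * a.coeff (a.natDegree - i)) {L : ℝ} (hL : 0 ≤ L)
    (hAa : ∀ z ∈ disc, ‖A z‖ ≤ L * ‖a.eval z‖) {c t : ℂ → ℂ} (hc : MemHInfty c) (ht : MemHInfty t)
    (hct : ∀ z ∈ disc, b z * c z + a.eval z * t z = 1) :
    ∃ K, 0 ≤ K ∧ ∀ f X, SqNormHbLe b f X → ∃ (h : ℂ → ℂ) (p : ℕ → ℂ), MemH2 h ∧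
      sqNormH2 h ≤ K * X ∧ (∀ n, ‖p n‖ ^ 2 ≤ K * X) ∧
      ∀ z ∈ disc, f z = a.eval z * h z + ∑ n ∈ Finset.range a.natDegree, p n * z ^ n := by
  obtain ⟨Cc, hCc⟩ := hc.2
  obtain ⟨Ct, hCt⟩ := ht.2
  obtain ⟨Ca, hCa⟩ := (memHInfty_polynomial a).2
  have h0 : (0 : ℂ) ∈ disc := by simp
  have hCc0 := (norm_nonneg _).trans (hCc 0 h0)
  have hCt0 := (norm_nonneg _).trans (hCt 0 h0)
  set M := L * Cc + Ct with hM
  have hM0 : 0 ≤ M := by positivity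
  set K₁ := ‖κ‖ ^ 2 * M ^ 2 with hK₁
  -- `K₁` serves `h`; the rest comes from `|pₙ|² ≤ 2 |fₙ|² + 2 |(ah)ₙ|²`.
  refine ⟨K₁ + 2 + 2 * Ca ^ 2 * K₁, by positivity, fun f X hf => ?_⟩
  have hX := hf.nonneg
  have key : ∀ g : ℂ[X], ‖⟪toL2 f, toL2 (fun z => g.eval z)⟫_ℂ‖ ≤
      (√X * M) * ‖toL2 (fun z => a.eval z * g.eval z)‖ := by
    intro g
    have hg := memH2_polynomial g
    have hag := (memHInfty_polynomial a).mul_memH2 hg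
    have hcg := hc.mul_memH2 hg
    have hbcg := P.memHInfty_left.mul_memH2 hcg
    have htag := ht.mul_memH2 hag
    -- By the Bézout identity `g = b (c g) + t (a g)`: the first term is handled by the norm of `f`
    -- in `ℋ(b)`, the second by its norm in `H²`.
    have e : toL2 (fun z => g.eval z) = toL2 (fun z => b z * (c z * g.eval z)) +
        toL2 (fun z => t z * (a.eval z * g.eval z)) := by
      rw [← toL2_add hbcg htag]
      refine toL2_congr fun z hz => ?_
      linear_combination -(g.eval z) * hct z hz
    rw [e, inner_add_right]
    have h1 := P.norm_inner_le hf hcg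
    have h2 := norm_inner_le_norm (𝕜 := ℂ) (toL2 f) (toL2 (fun z => t z * (a.eval z * g.eval z)))
    have h3 : ‖toL2 (fun z => A z * (c z * g.eval z))‖ ≤
        (L * Cc) * ‖toL2 (fun z => a.eval z * g.eval z)‖ :=
      norm_toL2_le (P.memHInfty_right.mul_memH2 hcg).1 hag (by positivity) fun z hz => by
        rw [norm_mul, norm_mul, norm_mul]
        calc _ ≤ (L * ‖a.eval z‖) * (Cc * ‖g.eval z‖) := by
              have := hAa z hz
              have := hCc z hz
              gcongr
          _ = _ := by ring
    have h4 : ‖toL2 (fun z => t z * (a.eval z * g.eval z))‖ ≤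
        Ct * ‖toL2 (fun z => a.eval z * g.eval z)‖ :=
      norm_toL2_le htag.1 hag hCt0 fun z hz => by
        rw [norm_mul]
        have := hCt z hz
        gcongr
    have h5 : ‖toL2 f‖ ≤ √X := by
      rw [norm_toL2 hf.1]; exact Real.sqrt_le_sqrt hf.sqNormH2_le
    refine (norm_add_le _ _).trans ?_
    calc _ ≤ √X * ((L * Cc) * ‖toL2 (fun z => a.eval z * g.eval z)‖) +
          √X * (Ct * ‖toL2 (fun z => a.eval z * g.eval z)‖) := by
          refine add_le_add (h1.trans ?_) (h2.trans ?_) <;> gcongr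
      _ = _ := by rw [hM]; ring
  obtain ⟨k, hk, hkn, hkf⟩ := exists_conj_toeplitz_eq hf.1 a (by positivity) key
  obtain ⟨h, hh, hhn, hfh⟩ := exists_eq_mul_add_polynomial hf.1 hk ha hkf
  have hhX : sqNormH2 h ≤ K₁ * X := by
    refine hhn.trans ?_
    rw [mul_pow, Real.sq_sqrt hX] at hkn
    calc _ ≤ ‖κ‖ ^ 2 * (X * M ^ 2) := by gcongr
      _ = _ := by rw [hK₁]; ring
  have hK₁0 : 0 ≤ K₁ := by positivity
  refine ⟨h, _, hh, hhX.trans ?_, fun n => ?_, hfh⟩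
  · gcongr
    nlinarith [mul_nonneg (sq_nonneg Ca) hK₁0]
  · have h1 := norm_taylorCoeff_sq_le hf.1 n
    have h2 := memH2_mul_of_bound a.differentiable.differentiableOn hCa hh
    have h3 := norm_taylorCoeff_sq_le h2.1 n
    have h4 := norm_sub_le (taylorCoeff f n) (taylorCoeff (fun z => a.eval z * h z) n)
    have h5 := pow_le_pow_left₀ (norm_nonneg _) h4 2
    have h6 : Ca ^ 2 * sqNormH2 h ≤ Ca ^ 2 * (K₁ * X) := by gcongr
    have h7 := hf.sqNormH2_le
    have h8 : 0 ≤ K₁ * X := by positivity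
    nlinarith [sq_nonneg (‖taylorCoeff f n‖ - ‖taylorCoeff (fun z => a.eval z * h z) n‖), h2.2]

end PythagoreanPair

/-- The functions in `ℋ(b)` are of the form `a h + p` with `h ∈ H^2` and a polynomial `p` of degree
less than `N`, with control of the norms. -/
def HasDecomposition (b a : ℂ → ℂ) (N : ℕ) : Prop :=
  ∃ K, 0 ≤ K ∧ ∀ f X, SqNormHbLe b f X → ∃ (h : ℂ → ℂ) (p : ℕ → ℂ), MemH2 h ∧
    sqNormH2 h ≤ K * X ∧ (∀ n, ‖p n‖ ^ 2 ≤ K * X) ∧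
    ∀ z ∈ disc, f z = a z * h z + ∑ n ∈ Finset.range N, p n * z ^ n

/-! ### From bounds by `1 - |b|²` to bounds by `|a|²` -/

/-- A maximum principle: bounds by `1 - |b|²` are turned into bounds by `|a|²`. -/
lemma norm_sq_le_of_norm_sq_le_one_sub {F a : ℂ → ℂ} {β : ℂ → ℝ} (hF : DifferentiableOn ℂ F disc)
    (ha : Differentiable ℂ a) (ha0 : ∀ z ∈ disc, a z ≠ 0)
    (hβ : ContinuousOn β (Metric.closedBall 0 1)) {C L : ℝ} (hC : 0 ≤ C) (hL : 0 ≤ L)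
    (hβa : ∀ z, ‖z‖ = 1 → ∀ s : ℝ, 0 ≤ s → s < 1 → β z ≤ L * ‖a (s * z)‖ ^ 2)
    (hFβ : ∀ z ∈ disc, ‖F z‖ ^ 2 ≤ C * β z) {z : ℂ} (hz : z ∈ disc) :
    ‖F z‖ ^ 2 ≤ C * (L + 1) * ‖a z‖ ^ 2 := by
  -- Division by `a` itself is uncontrolled near its zeros on the circle. The dilate `z ↦ a (s z)`
  -- has no zeros in the closed disc, and `s` tends to `1` at the end.
  have key : ∀ s : ℝ, 0 ≤ s → s < 1 → ‖F z‖ ^ 2 ≤ C * (L + 1) * ‖a (s * z)‖ ^ 2 := by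
    intro s hs0 hs1
    have hmem : ∀ w : ℂ, ‖w‖ ≤ 1 → (s : ℂ) * w ∈ disc := fun w hw => by
      rw [mem_disc, norm_mul, Complex.norm_real, Real.norm_of_nonneg hs0]
      exact mul_lt_one_of_nonneg_of_lt_one_left hs0 hs1 hw
    have hac : Continuous a := ha.continuous
    obtain ⟨w, hw, hmin⟩ := (isCompact_closedBall (0 : ℂ) 1).exists_isMinOn
      ⟨0, by simp⟩ (f := fun w => ‖a (s * w)‖ ^ 2) (by fun_prop)
    have hm : 0 < ‖a (s * w)‖ ^ 2 := by
      have := ha0 _ (hmem w (by simpa using hw))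
      positivity
    -- The error allowed near the circle is the minimum of `‖a (s w)‖²`, hence the `+ 1` in `L + 1`.
    obtain ⟨r₀, hr₀, hr⟩ := exists_radius_le_of_nonpos_on_circle
      (H := fun z => β z - L * ‖a (s * z)‖ ^ 2)
      (hβ.sub (by fun_prop)) (fun z hz => sub_nonpos.2 (hβa z hz s hs0 hs1)) hm
    have hdm : Set.MapsTo (fun w : ℂ => (s : ℂ) * w) disc disc :=
      fun w hw => hmem w (mem_disc.1 hw).le
    have hG : DifferentiableOn ℂ (fun w => F w / a (s * w)) disc :=
      hF.div (ha.comp (differentiable_id.const_mul (s : ℂ))).differentiableOn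
        fun w hw => ha0 _ (hdm hw)
    have h1 := norm_le_of_norm_le_near_circle hG (C := √(C * (L + 1))) hr₀ (fun w hw hwr => by
      refine Real.le_sqrt_of_sq_le ?_
      have hw1 := (mem_disc.1 hw).le
      have h2 := hr w hwr hw1
      have h3 : ‖a (s * _)‖ ^ 2 ≤ ‖a (s * w)‖ ^ 2 := hmin (show w ∈ Metric.closedBall (0 : ℂ) 1 by
        simpa using hw1)
      have h4 : 0 < ‖a (s * w)‖ ^ 2 := hm.trans_le h3
      rw [norm_div, div_pow, div_le_iff₀ h4]
      refine (hFβ w hw).trans ?_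
      rw [mul_assoc]
      gcongr
      linarith) hz
    have h4 : 0 < ‖a (s * z)‖ := norm_pos_iff.2 (ha0 _ (hdm hz))
    have h5 := pow_le_pow_left₀ (norm_nonneg _) h1 2
    rwa [Real.sq_sqrt (by positivity), norm_div, div_pow, div_le_iff₀ (by positivity)] at h5
  have hac : Continuous a := ha.continuous
  have hlim : Tendsto (fun s : ℝ => C * (L + 1) * ‖a (s * z)‖ ^ 2) (𝓝[<] 1)
      (𝓝 (C * (L + 1) * ‖a ((1 : ℝ) * z)‖ ^ 2)) :=
    (Continuous.tendsto (by fun_prop) 1).mono_left nhdsWithin_le_nhds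
  rw [Complex.ofReal_one, one_mul] at hlim
  refine ge_of_tendsto hlim ?_
  filter_upwards [Ioo_mem_nhdsLT (show (0 : ℝ) < 1 by norm_num)] with s hs
  exact key s hs.1.le hs.2

/-! ### Multipliers and boundedness of weighted composition operators -/

namespace PythagoreanPair

variable {b A : ℂ → ℂ}

lemma exists_sqNormHbLe_sum (P : PythagoreanPair b A) {F : ℕ → ℂ → ℂ} (hF : ∀ n, MemHb b (F n))
    (N : ℕ) : ∃ D, 0 ≤ D ∧ ∀ (p : ℕ → ℂ) (Y : ℝ), 0 ≤ Y → (∀ n, ‖p n‖ ^ 2 ≤ Y) →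
      SqNormHbLe b (fun z => ∑ n ∈ Finset.range N, p n * F n z) (D * Y) := by
  induction N with
  | zero => exact ⟨0, le_rfl, fun p Y _ _ => by simpa using P.sqNormHbLe_zero⟩
  | succ N ih =>
    obtain ⟨D, hD, h⟩ := ih
    refine ⟨2 * D + 2 * normHb b (F N) ^ 2, by positivity, fun p Y hY hp => ?_⟩
    simp only [Finset.sum_range_succ]
    refine ((h p Y hY hp).add P.memHInfty_left
      (P.sqNormHbLe_const_mul (hF N).sqNormHbLe (p N))).mono ?_
    nlinarith [mul_le_mul_of_nonneg_right (hp N) (sq_nonneg (normHb b (F N)))]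

/-- Multipliers: a bounded function which is the sum of a polynomial and of a function in `a H^∞`
maps `ℋ(b)` into itself. -/
lemma memHb_mul (P : PythagoreanPair b A) {a : ℂ → ℂ} {K : ℝ} {N : ℕ} (ha : MemHInfty a)
    (hK : ∀ z ∈ disc, ‖a z‖ ≤ K * ‖A z‖) (hdec : HasDecomposition b a N) {φ t : ℂ → ℂ} {s : ℂ[X]}
    (hφ : MemHInfty φ) (ht : MemHInfty t) (hst : ∀ z ∈ disc, φ z = s.eval z + a z * t z)
    {f : ℂ → ℂ} (hf : MemHb b f) : MemHb b (fun z => f z * φ z) := by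
  obtain ⟨_, _, hd⟩ := hdec
  obtain ⟨h, p, hh, -, -, hfz⟩ := hd f _ hf.sqNormHbLe
  set q : ℂ[X] := ∑ n ∈ Finset.range N, C (p n) * X ^ n with hq
  have hqz : ∀ z, q.eval z = ∑ n ∈ Finset.range N, p n * z ^ n := fun z => by
    simp [hq, eval_finsetSum]
  obtain ⟨L, hL⟩ := ha.2
  obtain ⟨X, hX⟩ := P.exists_sqNormHbLe_polynomial (s * q)
  -- With `f = a h + q` and `φ = s + a t`, the product is `a (h φ + t q) + s q`.
  have h1 := P.sqNormHbLe_mul ha.1 hL hK ((hφ.mul_memH2 hh).add (ht.mul_memH2 (memH2_polynomial q)))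
  refine ((h1.add P.memHInfty_left hX).congr fun z hz => ?_).memHb
  simp only [hfz z hz, ← hqz, eval_mul]
  rw [hst z hz]
  ring

/-- The sufficiency half: a summand `a h` of `f` is sent to `a w (h ∘ φ)`, and the polynomial
remainder to a combination of finitely many fixed elements `u φⁿ` of `ℋ(b)`. -/
lemma isBoundedOnHb (P : PythagoreanPair b A) {a : ℂ → ℂ} {K : ℝ} {N : ℕ} (ha : MemHInfty a)
    (hK : ∀ z ∈ disc, ‖a z‖ ≤ K * ‖A z‖) (hdec : HasDecomposition b a N) {φ u w : ℂ → ℂ}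
    (hφ : DifferentiableOn ℂ φ disc) (hm : Set.MapsTo φ disc disc) (hw : MemHInfty w)
    (huw : ∀ z ∈ disc, u z * a (φ z) = a z * w z) (hu : ∀ n, MemHb b (fun z => u z * φ z ^ n)) :
    IsBoundedOnHb b u φ := by
  obtain ⟨M, hM, hd⟩ := hdec
  obtain ⟨Kφ, hKφ, hcomp⟩ := exists_sqNormH2_comp_le hφ hm
  obtain ⟨L, hL⟩ := ha.2
  obtain ⟨W, hW⟩ := hw.2
  obtain ⟨D, hD, hsum⟩ := P.exists_sqNormHbLe_sum hu N
  set E := 2 * ((L ^ 2 + K ^ 2) * (W ^ 2 * (Kφ * M))) + 2 * (D * M) with hE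
  have hE0 : 0 ≤ E := by positivity
  have key : ∀ f X, SqNormHbLe b f X → SqNormHbLe b (weightedComp u φ f) (E * X) := by
    intro f X hf
    have hX := hf.nonneg
    obtain ⟨h, p, hh, hhX, hpX, hfz⟩ := hd f X hf
    obtain ⟨hc, hcX⟩ := hcomp h hh
    obtain ⟨hwc, hwcX⟩ := memH2_mul_of_bound hw.1 hW hc
    have h1 := P.sqNormHbLe_mul ha.1 hL hK hwc
    have h2 := hsum p (M * X) (by positivity) hpX
    refine ((h1.add P.memHInfty_left h2).congr fun z hz => ?_).mono ?_
    · rw [weightedComp, hfz _ (hm hz), mul_add, ← mul_assoc, ← mul_assoc, huw z hz, Finset.mul_sum]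
      congr 1
      exact Finset.sum_congr rfl fun n _ => by ring
    · have h3 : sqNormH2 (fun z => w z * h (φ z)) ≤ W ^ 2 * (Kφ * (M * X)) := by
        refine hwcX.trans ?_
        gcongr
        exact hcX.trans (by gcongr)
      have h4 := mul_le_mul_of_nonneg_left h3 (show 0 ≤ L ^ 2 + K ^ 2 by positivity)
      rw [hE]
      linarith
  refine ⟨fun f hf => (key f _ hf.sqNormHbLe).memHb, √E, fun f hf => ?_⟩
  refine (key f _ hf.sqNormHbLe).normHb_le.trans_eq ?_
  rw [Real.sqrt_mul hE0, Real.sqrt_sq (show 0 ≤ normHb b f from Real.sqrt_nonneg _)]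

/-- The necessity half. The test function `a k`, with `k` the Szegő kernel at `φ(z)`, has squared
norm at most a multiple of `(1 - |φ(z)|²)⁻¹`. The pointwise estimate for its image at `z` brings in
`(1 - |b(z)|²) / (1 - |z|²)`, and `hB` cancels the factors involving `φ(z)` and `z`. -/
lemma exists_norm_sq_le (P : PythagoreanPair b A) {a : ℂ → ℂ} {K B : ℝ} (ha : MemHInfty a)
    (hK : ∀ z ∈ disc, ‖a z‖ ≤ K * ‖A z‖) {φ u : ℂ → ℂ} (hm : Set.MapsTo φ disc disc)
    (hB : ∀ z ∈ disc, 1 - ‖φ z‖ ^ 2 ≤ B * (1 - ‖z‖ ^ 2)) (hu : IsBoundedOnHb b u φ) :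
    ∃ C, 0 ≤ C ∧ ∀ z ∈ disc, ‖u z * a (φ z)‖ ^ 2 ≤ C * (1 - ‖b z‖ ^ 2) := by
  obtain ⟨hmem, D, hD⟩ := hu
  obtain ⟨L, hL⟩ := ha.2
  have hB0 : 0 ≤ B := by
    have h0 : (0 : ℂ) ∈ disc := by simp
    have h1 := hB 0 h0
    have h2 := one_sub_norm_sq_pos (hm h0)
    rw [norm_zero] at h1
    linarith
  refine ⟨D ^ 2 * (L ^ 2 + K ^ 2) * B, by positivity, fun z hz => ?_⟩
  have hφz := hm hz
  have h1 := P.sqNormHbLe_mul ha.1 hL hK (memH2_szegoKernel hφz)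
  rw [sqNormH2_szegoKernel hφz] at h1
  have hd := one_sub_norm_sq_pos hφz
  have hdz := one_sub_norm_sq_pos hz
  have hβ : 0 ≤ 1 - ‖b z‖ ^ 2 := by
    have := P.sq_add_sq_le_one hz
    nlinarith [sq_nonneg ‖A z‖]
  have h2 := h1.normHb_le
  have h3 := (hmem _ h1.memHb).sqNormHbLe
  have h4 : normHb b (weightedComp u φ fun w => a w * szegoKernel (φ z) w) ^ 2 ≤
      D ^ 2 * ((L ^ 2 + K ^ 2) * (1 - ‖φ z‖ ^ 2)⁻¹) := by
    have h5 := pow_le_pow_left₀ (Real.sqrt_nonneg _) (hD _ h1.memHb) 2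
    refine h5.trans ?_
    rw [mul_pow]
    have h6 := pow_le_pow_left₀ (Real.sqrt_nonneg _) h2 2
    rw [Real.sq_sqrt h1.nonneg] at h6
    exact mul_le_mul_of_nonneg_left h6 (sq_nonneg D)
  have h7 := P.norm_sq_mul_le (h3.mono h4) hz (P.norm_lt_one hz)
  have hkz : szegoKernel (φ z) (φ z) = ((1 - ‖φ z‖ ^ 2 : ℝ) : ℂ)⁻¹ := by
    rw [szegoKernel, Complex.conj_mul']; push_cast; rfl
  rw [weightedComp, ← mul_assoc, norm_mul, hkz, norm_inv, Complex.norm_real,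
    Real.norm_of_nonneg hd.le] at h7
  set x := ‖u z * a (φ z)‖
  set d := 1 - ‖φ z‖ ^ 2
  set e := 1 - ‖z‖ ^ 2
  set β := 1 - ‖b z‖ ^ 2
  have h8 : x ^ 2 * e ≤ D ^ 2 * (L ^ 2 + K ^ 2) * β * d := by
    have h9 := mul_le_mul_of_nonneg_right h7 (sq_nonneg d)
    calc x ^ 2 * e = (x * d⁻¹) ^ 2 * e * d ^ 2 := by field_simp
      _ ≤ _ := h9
      _ = _ := by field_simp
  have h10 : D ^ 2 * (L ^ 2 + K ^ 2) * β * d ≤ D ^ 2 * (L ^ 2 + K ^ 2) * β * (B * e) := by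
    have := hB z hz
    gcongr
  refine le_of_mul_le_mul_right ?_ hdz
  linarith

end PythagoreanPair

/-! ### Rational functions -/

lemma ratFun_eq_div (r : RatFunc ℂ) (z : ℂ) : ratFun r z = r.num.eval z / r.denom.eval z := rfl

/-- Where the denominator vanishes `ratFun` takes the value `0`, so boundedness says nothing there
directly. The inequality `|num| ≤ C |denom|` is proved off the finite zero set and extended by
density; a zero of the denominator would then be shared with the numerator. -/
lemma denom_eval_ne_zero {r : RatFunc ℂ} (h : MemHInfty (ratFun r)) {ζ : ℂ} (hζ : ‖ζ‖ ≤ 1) :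
    r.denom.eval ζ ≠ 0 := by
  intro h0
  obtain ⟨C, hC⟩ := h.2
  set F : Set ℂ := {z | r.denom.eval z = 0} with hF
  have hfin : F.Finite := by
    refine (r.denom.roots.toFinset.finite_toSet).subset fun z hz => ?_
    simp only [Finset.mem_coe, Multiset.mem_toFinset]
    exact (mem_roots r.denom_ne_zero).2 hz
  have hsub : Metric.closedBall (0 : ℂ) 1 ⊆ {z | ‖r.num.eval z‖ ≤ C * ‖r.denom.eval z‖} := by
    have hcl : IsClosed {z : ℂ | ‖r.num.eval z‖ ≤ C * ‖r.denom.eval z‖} :=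
      isClosed_le (by fun_prop) (by fun_prop)
    have h1 : disc ∩ Fᶜ ⊆ {z | ‖r.num.eval z‖ ≤ C * ‖r.denom.eval z‖} := by
      rintro z ⟨hz, hzF⟩
      have h2 := hC z hz
      have h3 : 0 < ‖r.denom.eval z‖ := norm_pos_iff.2 hzF
      rw [ratFun_eq_div, norm_div, div_le_iff₀ h3] at h2
      exact h2
    rw [← closure_ball (0 : ℂ) one_ne_zero]
    exact closure_minimal (((hfin.countable.dense_compl ℂ).open_subset_closure_inter
      isOpen_disc).trans (closure_minimal h1 hcl)) hcl
  have h4 : ‖r.num.eval ζ‖ ≤ C * ‖r.denom.eval ζ‖ := hsub (by simpa using hζ)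
  rw [h0, norm_zero, mul_zero, norm_le_zero_iff] at h4
  obtain ⟨s, t, hst⟩ := r.isCoprime_num_denom
  have := congrArg (eval ζ) hst
  simp [h0, h4] at this

lemma continuousOn_ratFun {r : RatFunc ℂ} (h : MemHInfty (ratFun r)) :
    ContinuousOn (ratFun r) (Metric.closedBall 0 1) :=
  r.num.continuous.continuousOn.div r.denom.continuous.continuousOn fun z hz =>
    denom_eval_ne_zero h (by simpa using hz)

lemma IsOuter.ne_zero {F : ℂ → ℂ} (h : IsOuter F) {z : ℂ} (hz : z ∈ disc) : F z ≠ 0 := by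
  obtain ⟨c, _, hc, -, hF⟩ := h
  rw [hF z hz]
  refine mul_ne_zero ?_ (Complex.exp_ne_zero _)
  rintro rfl
  simp at hc

lemma IsPythagoreanMate.pythagoreanPair {b A : RatFunc ℂ} (hb : MemHInfty (ratFun b))
    (hA : IsPythagoreanMate b A) : PythagoreanPair (ratFun b) (ratFun A) where
  diff_b := hb.1
  diff_A := hA.1.1
  cont_b := continuousOn_ratFun hb
  cont_A := continuousOn_ratFun hA.1
  sq_add_sq := hA.2.2.1
  ne_zero := fun _ hz => hA.2.1.ne_zero hz

/-- The polynomial with the zeros of `A` on the unit circle. -/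
noncomputable def boundaryPoly (A : RatFunc ℂ) : ℂ[X] :=
  ∏ ζ ∈ circleZeros A, (X - C ζ) ^ zeroMult A ζ

lemma boundaryPoly_eval (A : RatFunc ℂ) (z : ℂ) : (boundaryPoly A).eval z = boundaryFactor A z := by
  simp [boundaryPoly, boundaryFactor, eval_prod]

lemma mem_circleZeros {A : RatFunc ℂ} {ζ : ℂ} :
    ζ ∈ circleZeros A ↔ (A.num ≠ 0 ∧ A.num.eval ζ = 0) ∧ ‖ζ‖ = 1 := by
  simp [circleZeros]

lemma boundaryFactor_eq_zero {A : RatFunc ℂ} {z : ℂ} (h : boundaryFactor A z = 0) :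
    z ∈ circleZeros A := by
  obtain ⟨ζ, hζ, h0⟩ := Finset.prod_eq_zero_iff.1 h
  by_contra hz
  exact pow_ne_zero _ (sub_ne_zero.2 fun h => hz (by rwa [h])) h0

lemma exists_num_eq_boundaryPoly_mul {A : RatFunc ℂ} (h : ∀ z ∈ disc, ratFun A z ≠ 0) :
    ∃ q, A.num = boundaryPoly A * q ∧ ∀ z, ‖z‖ ≤ 1 → q.eval z ≠ 0 := by
  have hdvd : boundaryPoly A ∣ A.num := by
    refine Finset.prod_dvd_of_coprime (fun ζ _ ξ _ hne => ?_) fun ζ _ =>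
      pow_rootMultiplicity_dvd _ _
    exact (isCoprime_X_sub_C_of_isUnit_sub (sub_ne_zero.2 hne).isUnit).pow
  obtain ⟨q, hq⟩ := hdvd
  have hnum : ∀ z ∈ disc, A.num.eval z ≠ 0 := fun z hz h0 => h z hz (by
    rw [ratFun_eq_div, h0, zero_div])
  have hne : A.num ≠ 0 := by
    intro h0
    have := hnum 0 (by simp)
    rw [h0] at this
    simp at this
  refine ⟨q, hq, fun z hz h0 => ?_⟩
  have hA0 : A.num.eval z = 0 := by rw [hq, eval_mul, h0, mul_zero]
  rcases hz.lt_or_eq with hz | hz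
  · exact hnum z (mem_disc.2 hz) hA0
  · have hmem : z ∈ circleZeros A := mem_circleZeros.2 ⟨⟨hne, hA0⟩, hz⟩
    have h1 : (X - C z) ^ zeroMult A z ∣ boundaryPoly A :=
      Finset.dvd_prod_of_mem (fun ζ => (X - C ζ) ^ zeroMult A ζ) hmem
    -- One more factor `X - C z` would exceed the multiplicity of the root `z` of the numerator.
    have h2 : X - C z ∣ q := dvd_iff_isRoot.2 h0
    have h3 := mul_dvd_mul h1 h2
    rw [← pow_succ, ← hq] at h3
    exact pow_rootMultiplicity_not_dvd hne z h3

lemma exists_bounds_boundaryFactor {A : RatFunc ℂ} (hA : MemHInfty (ratFun A))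
    (h : ∀ z ∈ disc, ratFun A z ≠ 0) : ∃ L, 0 ≤ L ∧ ∀ z, ‖z‖ ≤ 1 →
      ‖ratFun A z‖ ≤ L * ‖boundaryFactor A z‖ ∧ ‖boundaryFactor A z‖ ≤ L * ‖ratFun A z‖ := by
  obtain ⟨q, hq, hq0⟩ := exists_num_eq_boundaryPoly_mul h
  have hd0 : ∀ z, ‖z‖ ≤ 1 → A.denom.eval z ≠ 0 := fun z hz => denom_eval_ne_zero hA hz
  have hc1 : ContinuousOn (fun z => q.eval z / A.denom.eval z) (Metric.closedBall 0 1) :=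
    q.continuous.continuousOn.div A.denom.continuous.continuousOn fun z hz =>
      hd0 z (by simpa using hz)
  have hc2 : ContinuousOn (fun z => A.denom.eval z / q.eval z) (Metric.closedBall 0 1) :=
    A.denom.continuous.continuousOn.div q.continuous.continuousOn fun z hz =>
      hq0 z (by simpa using hz)
  obtain ⟨L₁, h₁⟩ := (isCompact_closedBall (0 : ℂ) 1).exists_bound_of_continuousOn hc1
  obtain ⟨L₂, h₂⟩ := (isCompact_closedBall (0 : ℂ) 1).exists_bound_of_continuousOn hc2
  have hAz : ∀ z, ratFun A z = q.eval z / A.denom.eval z * boundaryFactor A z := fun z => by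
    rw [ratFun_eq_div, hq, eval_mul, boundaryPoly_eval]; ring
  refine ⟨max L₁ L₂, ?_, fun z hz => ?_⟩
  · exact ((norm_nonneg _).trans (h₁ 0 (by simp))).trans (le_max_left _ _)
  have hz' : z ∈ Metric.closedBall (0 : ℂ) 1 := by simpa using hz
  constructor
  · rw [hAz, norm_mul]
    exact mul_le_mul_of_nonneg_right ((h₁ z hz').trans (le_max_left _ _)) (norm_nonneg _)
  · have h3 : boundaryFactor A z = A.denom.eval z / q.eval z * ratFun A z := by
      rw [hAz]
      have := hd0 z hz
      have := hq0 z hz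
      field_simp
    rw [h3, norm_mul]
    exact mul_le_mul_of_nonneg_right ((h₂ z hz').trans (le_max_right _ _)) (norm_nonneg _)

lemma reverse_X_sub_C {ζ : ℂ} (h : ‖ζ‖ = 1) :
    (X - C ζ).reverse = C (-ζ) * (X - C ζ).map (starRingEnd ℂ) := by
  have h1 : ζ * conj ζ = 1 := by rw [Complex.mul_conj']; simp [h]
  ext n
  rw [coeff_reverse, natDegree_X_sub_C, Polynomial.map_sub, map_X, map_C, coeff_C_mul]
  rcases n with _ | _ | n
  · simp [revAt_le, h1]
  · simp [revAt_le]
  · rw [revAt_eq_self_of_lt (by omega)]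
    simp [coeff_X]

lemma exists_reverse_boundaryPoly (A : RatFunc ℂ) :
    ∃ κ : ℂ, κ ≠ 0 ∧ (boundaryPoly A).reverse = C κ * (boundaryPoly A).map (starRingEnd ℂ) := by
  have hpow : ∀ (ζ : ℂ), ‖ζ‖ = 1 → ∀ m : ℕ, ∃ κ : ℂ, κ ≠ 0 ∧
      ((X - C ζ) ^ m).reverse = C κ * ((X - C ζ) ^ m).map (starRingEnd ℂ) := by
    intro ζ hζ m
    induction m with
    | zero => exact ⟨1, one_ne_zero, by simpa using reverse_C (1 : ℂ)⟩
    | succ m ih =>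
      obtain ⟨κ, hκ, h⟩ := ih
      refine ⟨κ * -ζ, mul_ne_zero hκ (neg_ne_zero.2 fun h0 => by simp [h0] at hζ), ?_⟩
      rw [pow_succ, reverse_mul_of_domain, h, reverse_X_sub_C hζ, Polynomial.map_mul, C_mul]
      ring
  have hprod : ∀ s : Finset ℂ, (∀ ζ ∈ s, ‖ζ‖ = 1) → ∃ κ : ℂ, κ ≠ 0 ∧
      (∏ ζ ∈ s, (X - C ζ) ^ zeroMult A ζ).reverse =
        C κ * (∏ ζ ∈ s, (X - C ζ) ^ zeroMult A ζ).map (starRingEnd ℂ) := by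
    intro s
    induction s using Finset.induction_on with
    | empty => exact fun _ => ⟨1, one_ne_zero, by simpa using reverse_C (1 : ℂ)⟩
    | insert ζ s hζ ih =>
      intro hs
      obtain ⟨κ, hκ, h⟩ := ih fun ξ hξ => hs ξ (Finset.mem_insert_of_mem hξ)
      obtain ⟨κ', hκ', h'⟩ := hpow ζ (hs ζ (Finset.mem_insert_self _ _)) (zeroMult A ζ)
      refine ⟨κ' * κ, mul_ne_zero hκ' hκ, ?_⟩
      rw [Finset.prod_insert hζ, reverse_mul_of_domain, h, h', Polynomial.map_mul, C_mul]
      ring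
  exact hprod _ fun ζ hζ => (mem_circleZeros.1 hζ).2

lemma exists_conj_coeff_boundaryPoly (A : RatFunc ℂ) : ∃ κ : ℂ, ∀ i ≤ (boundaryPoly A).natDegree,
    conj ((boundaryPoly A).coeff i) =
      κ * (boundaryPoly A).coeff ((boundaryPoly A).natDegree - i) := by
  obtain ⟨κ, hκ, h⟩ := exists_reverse_boundaryPoly A
  refine ⟨κ⁻¹, fun i hi => ?_⟩
  have h1 := congrArg (fun p => coeff p i) h
  simp only [coeff_reverse, coeff_C_mul, coeff_map, revAt_le hi] at h1
  rw [h1, inv_mul_cancel_left₀ hκ]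

/-- For a zero `ζ`, `|z - s z| ≤ 1 - s ≤ |s z - ζ|`, so each factor at most doubles. -/
lemma norm_boundaryFactor_le (A : RatFunc ℂ) {z : ℂ} (hz : ‖z‖ ≤ 1) {s : ℝ} (hs0 : 0 ≤ s)
    (hs1 : s < 1) : ‖boundaryFactor A z‖ ≤
      (∏ ζ ∈ circleZeros A, (2 : ℝ) ^ zeroMult A ζ) * ‖boundaryFactor A (s * z)‖ := by
  rw [boundaryFactor, boundaryFactor, norm_prod, norm_prod, ← Finset.prod_mul_distrib]
  refine Finset.prod_le_prod (fun _ _ => norm_nonneg _) fun ζ hζ => ?_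
  rw [norm_pow, norm_pow, ← mul_pow]
  refine pow_le_pow_left₀ (norm_nonneg _) ?_ _
  have hζ1 := (mem_circleZeros.1 hζ).2
  have h1 : ‖z - s * z‖ ≤ 1 - s := by
    have : z - s * z = ((1 - s : ℝ) : ℂ) * z := by push_cast; ring
    rw [this, norm_mul, Complex.norm_real, Real.norm_of_nonneg (by linarith)]
    exact mul_le_of_le_one_right (by linarith) hz
  have h2 : 1 - s ≤ ‖s * z - ζ‖ := by
    have h3 := norm_sub_norm_le ζ (s * z)
    rw [norm_sub_rev, hζ1, norm_mul, Complex.norm_real, Real.norm_of_nonneg hs0] at h3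
    have := mul_le_of_le_one_right hs0 hz
    linarith
  have h4 := norm_add_le (z - s * z) (s * z - ζ)
  rw [sub_add_sub_cancel] at h4
  linarith

lemma isCoprime_boundaryPoly {A : RatFunc ℂ} {p : ℂ[X]} (h : ∀ ζ ∈ circleZeros A, p.eval ζ ≠ 0) :
    IsCoprime p (boundaryPoly A) := by
  rw [isCoprime_iff_aeval_ne_zero_of_isAlgClosed ℂ ℂ]
  intro z
  simp only [coe_aeval_eq_eval]
  by_contra! hz
  exact h z (boundaryFactor_eq_zero (by rw [← boundaryPoly_eval]; exact hz.2)) hz.1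

lemma IsPythagoreanMate.hasDecomposition {b A : RatFunc ℂ} (hb : MemHInfty (ratFun b))
    (hA : IsPythagoreanMate b A) :
    HasDecomposition (ratFun b) (boundaryFactor A) (boundaryPoly A).natDegree := by
  have P := hA.pythagoreanPair hb
  obtain ⟨κ, hκ⟩ := exists_conj_coeff_boundaryPoly A
  obtain ⟨L, hL0, hL⟩ := exists_bounds_boundaryFactor hA.1 P.ne_zero
  -- At a zero of `A` on the circle `|b| = 1`, so the numerator of `b` does not vanish there.
  have hcop : IsCoprime b.num (boundaryPoly A) := by
    refine isCoprime_boundaryPoly fun ζ hζ h0 => ?_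
    obtain ⟨⟨-, hA0⟩, h1⟩ := mem_circleZeros.1 hζ
    have := P.sq_add_sq ζ h1
    rw [ratFun_eq_div, ratFun_eq_div, hA0, h0] at this
    simp at this
  obtain ⟨s, t, hst⟩ := hcop
  obtain ⟨K, hK, h⟩ := P.exists_decomposition hκ hL0
    (fun z hz => by rw [boundaryPoly_eval]; exact (hL z (mem_disc.1 hz).le).1)
    (memHInfty_polynomial (s * b.denom)) (memHInfty_polynomial t) fun z hz => by
      have h1 := congrArg (eval z) hst
      have h2 := denom_eval_ne_zero hb (mem_disc.1 hz).le
      simp only [eval_add, eval_mul, eval_one] at h1 ⊢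
      rw [ratFun_eq_div, ← h1]
      field_simp
  exact ⟨K, hK, by simpa only [boundaryPoly_eval] using h⟩

/-! ### Finite Blaschke products -/

lemma one_sub_conj_mul_ne_zero {α z : ℂ} (hα : ‖α‖ < 1) (hz : ‖z‖ ≤ 1) : 1 - conj α * z ≠ 0 := by
  intro h
  have h1 : ‖conj α * z‖ = 1 := by rw [← sub_eq_zero.1 h, norm_one]
  rw [norm_mul, RCLike.norm_conj] at h1
  have := mul_lt_one_of_nonneg_of_lt_one_left (norm_nonneg α) hα hz
  linarith

lemma normSq_blaschke (α z : ℂ) :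
    ‖1 - conj α * z‖ ^ 2 - ‖z - α‖ ^ 2 = (1 - ‖α‖ ^ 2) * (1 - ‖z‖ ^ 2) := by
  simp only [← Complex.normSq_eq_norm_sq, Complex.normSq_apply, Complex.sub_re, Complex.sub_im,
    Complex.mul_re, Complex.mul_im, Complex.conj_re, Complex.conj_im, Complex.one_re,
    Complex.one_im]
  ring

lemma norm_blaschke_factor {α z : ℂ} (hα : ‖α‖ < 1) (hz : ‖z‖ < 1) :
    ‖(z - α) / (1 - conj α * z)‖ ≤ 1 ∧ 1 - ‖(z - α) / (1 - conj α * z)‖ ^ 2 ≤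
      (1 - ‖α‖ ^ 2) / (1 - ‖α‖) ^ 2 * (1 - ‖z‖ ^ 2) := by
  have h0 := one_sub_conj_mul_ne_zero hα hz.le
  have h1 := normSq_blaschke α z
  have hα2 : 0 < 1 - ‖α‖ ^ 2 := by nlinarith [norm_nonneg α]
  have hz2 : 0 < 1 - ‖z‖ ^ 2 := by nlinarith [norm_nonneg z]
  have h2 : 0 < ‖1 - conj α * z‖ := norm_pos_iff.2 h0
  have h3 : 1 - ‖α‖ ≤ ‖1 - conj α * z‖ := by
    have h4 := norm_sub_norm_le 1 (conj α * z)
    rw [norm_one, norm_mul, RCLike.norm_conj] at h4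
    have := mul_le_of_le_one_right (norm_nonneg α) hz.le
    linarith
  constructor
  · rw [norm_div, div_le_one h2]
    refine le_of_sq_le_sq ?_ h2.le
    have := mul_pos hα2 hz2
    linarith
  · have h5 : 1 - ‖(z - α) / (1 - conj α * z)‖ ^ 2 =
        (1 - ‖α‖ ^ 2) * (1 - ‖z‖ ^ 2) / ‖1 - conj α * z‖ ^ 2 := by
      rw [← h1, norm_div, div_pow, sub_div, div_self (by positivity)]
    rw [h5, div_mul_eq_mul_div]
    have h6 : 0 < 1 - ‖α‖ := by linarith
    gcongr

lemma exists_one_sub_norm_sq_blaschke_le (S : Multiset ℂ) (hS : ∀ α ∈ S, ‖α‖ < 1) :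
    ∃ B : ℝ, ∀ z ∈ disc, ‖(S.map fun α => (z - α) / (1 - conj α * z)).prod‖ ≤ 1 ∧
      1 - ‖(S.map fun α => (z - α) / (1 - conj α * z)).prod‖ ^ 2 ≤ B * (1 - ‖z‖ ^ 2) := by
  induction S using Multiset.induction_on with
  | empty => exact ⟨0, by simp⟩
  | cons α S ih =>
    obtain ⟨B, hB⟩ := ih fun β hβ => hS β (Multiset.mem_cons_of_mem hβ)
    -- The constants add up because `1 - x² y² ≤ (1 - x²) + (1 - y²)` for `x, y` in `[0, 1]`.
    refine ⟨(1 - ‖α‖ ^ 2) / (1 - ‖α‖) ^ 2 + B, fun z hz => ?_⟩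
    obtain ⟨h1, h2⟩ := hB z hz
    obtain ⟨h3, h4⟩ := norm_blaschke_factor (hS α (Multiset.mem_cons_self _ _)) (mem_disc.1 hz)
    rw [Multiset.map_cons, Multiset.prod_cons, norm_mul]
    set x := ‖(z - α) / (1 - conj α * z)‖
    set y := ‖(S.map fun α => (z - α) / (1 - conj α * z)).prod‖
    have hx0 : 0 ≤ x := norm_nonneg _
    have hy0 : 0 ≤ y := norm_nonneg _
    refine ⟨mul_le_one₀ h3 hy0 h1, ?_⟩
    have hx2 : x ^ 2 ≤ 1 := pow_le_one₀ hx0 h3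
    have hy2 : y ^ 2 ≤ 1 := pow_le_one₀ hy0 h1
    nlinarith

lemma IsFiniteBlaschkeProduct.exists_one_sub_norm_sq_le {φ : ℂ → ℂ}
    (h : IsFiniteBlaschkeProduct φ) :
    ∃ B : ℝ, ∀ z ∈ disc, 1 - ‖φ z‖ ^ 2 ≤ B * (1 - ‖z‖ ^ 2) := by
  obtain ⟨c, S, hc, hS, hφ⟩ := h
  obtain ⟨B, hB⟩ := exists_one_sub_norm_sq_blaschke_le S hS
  refine ⟨B, fun z hz => ?_⟩
  rw [hφ z hz, norm_mul, hc, one_mul]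
  exact (hB z hz).2

lemma IsFiniteBlaschkeProduct.exists_eq_div {φ : ℂ → ℂ} (h : IsFiniteBlaschkeProduct φ) :
    ∃ p q : ℂ[X], (∀ z, ‖z‖ ≤ 1 → q.eval z ≠ 0) ∧ ∀ z ∈ disc, φ z = p.eval z / q.eval z := by
  obtain ⟨c, S, -, hS, hφ⟩ := h
  refine ⟨C c * (S.map fun α => X - C α).prod, (S.map fun α => 1 - C (conj α) * X).prod,
    fun z hz h0 => ?_, fun z hz => ?_⟩
  · rw [eval_multiset_prod, Multiset.map_map, Multiset.prod_eq_zero_iff, Multiset.mem_map] at h0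
    obtain ⟨α, hα, h0⟩ := h0
    exact one_sub_conj_mul_ne_zero (hS α hα) hz (by simpa using h0)
  · rw [hφ z hz, Multiset.prod_map_div, eval_mul, eval_C, eval_multiset_prod, eval_multiset_prod,
      Multiset.map_map, Multiset.map_map, mul_div_assoc]
    simp

/-- Along the radius, `|φ(rζ)|² ≥ 1 - B (1 - r²)`, which tends to `1`. -/
lemma IsFiniteBlaschkeProduct.norm_eq_one_of_hasNTLimit {φ : ℂ → ℂ}
    (h : IsFiniteBlaschkeProduct φ) {ζ l : ℂ} (hζ : ‖ζ‖ = 1) (hl : HasNTLimit φ ζ l) :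
    1 ≤ ‖l‖ := by
  obtain ⟨B, hB⟩ := h.exists_one_sub_norm_sq_le
  have hr : ∀ᶠ r : ℝ in 𝓝[<] 1, 0 < r ∧ r < 1 := Ioo_mem_nhdsLT (show (0 : ℝ) < 1 by norm_num)
  have hnorm : ∀ r : ℝ, 0 < r → ‖(r : ℂ) * ζ‖ = r := fun r hr0 => by
    rw [norm_mul, hζ, mul_one, Complex.norm_real, Real.norm_of_nonneg hr0.le]
  have hlim : Tendsto (fun r : ℝ => (r : ℂ) * ζ) (𝓝[<] 1)
      (nhdsWithin ζ {z | ‖z‖ < 1 ∧ ‖z - ζ‖ < 2 * (1 - ‖z‖)}) := by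
    refine tendsto_nhdsWithin_iff.2 ⟨?_, ?_⟩
    · have : Tendsto (fun r : ℝ => (r : ℂ) * ζ) (𝓝 1) (𝓝 ((1 : ℝ) * ζ)) :=
        Continuous.tendsto (by fun_prop) 1
      rw [Complex.ofReal_one, one_mul] at this
      exact this.mono_left nhdsWithin_le_nhds
    · filter_upwards [hr] with r hr
      rw [hnorm r hr.1]
      refine ⟨hr.2, ?_⟩
      have e : (r : ℂ) * ζ - ζ = ((r - 1 : ℝ) : ℂ) * ζ := by push_cast; ring
      rw [e, norm_mul, hζ, mul_one, Complex.norm_real, Real.norm_of_nonpos (by linarith [hr.2])]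
      linarith [hr.2]
  have h1 := (((hl 2 one_lt_two).comp hlim).norm.pow 2)
  have h2 : Tendsto (fun r : ℝ => 1 - B * (1 - r ^ 2)) (𝓝[<] 1) (𝓝 (1 - B * (1 - 1 ^ 2))) :=
    (Continuous.tendsto (by fun_prop) 1).mono_left nhdsWithin_le_nhds
  have h3 := le_of_tendsto_of_tendsto h2 h1 (by
    filter_upwards [hr] with r hr
    have := hB (r * ζ) (by rw [mem_disc, hnorm r hr.1]; exact hr.2)
    rw [hnorm r hr.1] at this
    simp only [Function.comp_apply]
    linarith)
  nlinarith [norm_nonneg l]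

lemma IsFiniteBlaschkeProduct.hardyWeight_eq {φ : ℂ → ℂ} (h : IsFiniteBlaschkeProduct φ)
    (A : RatFunc ℂ) (u : ℂ → ℂ) :
    hardyWeight A u φ = fun z => u z * boundaryFactor A (φ z) / boundaryFactor A z := by
  have hempty : interiorZeros A u φ = ∅ := by
    refine Finset.eq_empty_of_forall_notMem fun ζ hmem => ?_
    simp only [interiorZeros, Finset.mem_filter] at hmem
    obtain ⟨hζ, -, l, hl, hφ⟩ := hmem
    have h1 := h.norm_eq_one_of_hasNTLimit (mem_circleZeros.1 hζ).2 hφ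
    have h2 := mem_disc.1 hl
    linarith
  funext z
  simp [hardyWeight, hempty]

/-- Write `φ = p / q` with `q` zero-free on the closed disc. From `s q + t a = 1` one gets `φ = s p
+ a (t φ)`, the form required of a multiplier. -/
lemma IsPythagoreanMate.memHb_mul_blaschke {b A : RatFunc ℂ} (hb : MemHInfty (ratFun b))
    (hA : IsPythagoreanMate b A) {φ f : ℂ → ℂ} (hφ : IsFiniteBlaschkeProduct φ)
    (hφb : MemHInfty φ) (hf : MemHb (ratFun b) f) : MemHb (ratFun b) (fun z => f z * φ z) := by
  have P := hA.pythagoreanPair hb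
  obtain ⟨L, -, hL⟩ := exists_bounds_boundaryFactor hA.1 P.ne_zero
  have ha : MemHInfty (boundaryFactor A) := by
    simpa only [boundaryPoly_eval] using memHInfty_polynomial (boundaryPoly A)
  obtain ⟨p, q, hq, hφz⟩ := hφ.exists_eq_div
  obtain ⟨s, t, hst⟩ := isCoprime_boundaryPoly (A := A) (p := q) fun ζ hζ =>
    hq ζ (mem_circleZeros.1 hζ).2.le
  refine P.memHb_mul ha (fun z hz => (hL z (mem_disc.1 hz).le).2) (hA.hasDecomposition hb) (s := s * p)
    hφb ((memHInfty_polynomial t).mul hφb) (fun z hz => ?_) hf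
  have h1 := congrArg (eval z) hst
  have h2 := hq z (mem_disc.1 hz).le
  simp only [eval_add, eval_mul, eval_one, boundaryPoly_eval] at h1 ⊢
  calc φ z = (eval z s * eval z q + eval z t * boundaryFactor A z) * φ z := by rw [h1, one_mul]
    _ = _ := by rw [hφz z hz]; field_simp

end

end DeBranges

/-! ### The characterization of the admissible weights -/

theorem theorem7p1 (b : RatFunc ℂ)
    (hb : DeBranges.MemHInfty (DeBranges.ratFun b))
    (hb_norm : DeBranges.normHInfty (DeBranges.ratFun b) = 1)
    (hb_not : ¬ DeBranges.IsFiniteBlaschkeProduct (DeBranges.ratFun b))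
    (A : RatFunc ℂ) (hA : DeBranges.IsPythagoreanMate b A)
    (φ : ℂ → ℂ) (hφ_maps : Set.MapsTo φ DeBranges.disc DeBranges.disc)
    (hφ : DeBranges.IsFiniteBlaschkeProduct φ) :
    DeBranges.admissibleWeights φ (DeBranges.ratFun b) =
      {u | DeBranges.MemHb (DeBranges.ratFun b) u ∧
        DeBranges.MemHb (DeBranges.ratFun b) (fun z => u z * φ z) ∧
        DeBranges.MemHInfty (DeBranges.hardyWeight A u φ)} := by
  open DeBranges in
  have P := hA.pythagoreanPair hb
  obtain ⟨L, hL0, hL⟩ := exists_bounds_boundaryFactor hA.1 P.ne_zero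
  have hK : ∀ z ∈ disc, ‖boundaryFactor A z‖ ≤ L * ‖ratFun A z‖ := fun z hz =>
    (hL z (mem_disc.1 hz).le).2
  have ha : MemHInfty (boundaryFactor A) := by
    simpa only [boundaryPoly_eval] using memHInfty_polynomial (boundaryPoly A)
  have had : Differentiable ℂ (boundaryFactor A) := by
    simpa only [boundaryPoly_eval] using (boundaryPoly A).differentiable
  have ha0 : ∀ z ∈ disc, boundaryFactor A z ≠ 0 := fun z hz h0 => by
    have h1 := (mem_circleZeros.1 (boundaryFactor_eq_zero h0)).2
    have h2 := mem_disc.1 hz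
    linarith
  have hφd : DifferentiableOn ℂ φ disc := by
    obtain ⟨p, q, hq, hφz⟩ := hφ.exists_eq_div
    exact (p.differentiable.differentiableOn.div q.differentiable.differentiableOn
      fun z hz => hq z (mem_disc.1 hz).le).congr hφz
  have hφb : MemHInfty φ := ⟨hφd, 1, fun z hz => (mem_disc.1 (hφ_maps hz)).le⟩
  have hmul : ∀ f, MemHb (ratFun b) f → MemHb (ratFun b) (fun z => f z * φ z) := fun f hf =>
    hA.memHb_mul_blaschke hb hφ hφb hf
  ext u
  change u ∈ admissibleWeights φ (ratFun b) ↔ MemHb (ratFun b) u ∧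
    MemHb (ratFun b) (fun z => u z * φ z) ∧ MemHInfty (hardyWeight A u φ)
  rw [hφ.hardyWeight_eq]
  constructor
  · rintro ⟨hu, hbd⟩
    obtain ⟨B, hB⟩ := hφ.exists_one_sub_norm_sq_le
    obtain ⟨C, hC, hF⟩ := P.exists_norm_sq_le ha hK hφ_maps hB hbd
    have hFd : DifferentiableOn ℂ (fun z => u z * boundaryFactor A (φ z)) disc :=
      hu.1.1.mul (had.comp_differentiableOn hφd)
    refine ⟨hu, hmul u hu, hFd.div had.differentiableOn ha0, ?_⟩
    -- `D` compares `a` with its dilates and `L` compares `A` with `a`, so on the circle `1 - |b|² =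
    -- |A|² ≤ (L D)² |a (s ·)|²`.
    set D := ∏ ζ ∈ circleZeros A, (2 : ℝ) ^ zeroMult A ζ with hD
    have hD0 : 0 ≤ D := by positivity
    refine ⟨√(C * ((L * D) ^ 2 + 1)), fun z hz => Real.le_sqrt_of_sq_le ?_⟩
    have hbc := P.cont_b
    have h1 := norm_sq_le_of_norm_sq_le_one_sub (β := fun z => 1 - ‖ratFun b z‖ ^ 2) hFd had ha0
      (by fun_prop) hC (sq_nonneg (L * D)) (fun w hw s hs0 hs1 => by
        have h2 := P.sq_add_sq w hw
        have h3 := (hL w hw.le).1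
        have h4 := norm_boundaryFactor_le A hw.le hs0 hs1
        have h5 : ‖ratFun A w‖ ≤ L * D * ‖boundaryFactor A (s * w)‖ := by
          rw [mul_assoc]
          exact h3.trans (mul_le_mul_of_nonneg_left h4 hL0)
        have h6 := pow_le_pow_left₀ (norm_nonneg _) h5 2
        rw [mul_pow (L * D)] at h6
        linarith) hF hz
    have h7 : 0 < ‖boundaryFactor A z‖ := norm_pos_iff.2 (ha0 z hz)
    rwa [norm_div, div_pow, div_le_iff₀ (by positivity)]
  · rintro ⟨hu, -, hw⟩
    refine ⟨hu, P.isBoundedOnHb ha hK (hA.hasDecomposition hb) hφd hφ_maps hw (fun z hz => ?_)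
      fun n => ?_⟩
    · rw [mul_div_cancel₀ _ (ha0 z hz)]
    · induction n with
      | zero => simpa using hu
      | succ n ih => simpa only [pow_succ, mul_assoc] using hmul _ ih
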